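/- Let $n\ge 1$, let $\alpha>0$ and $0<T<\infty$, and let $\Sigma$ be a compact connected smooth $n$-dimensional manifold without boundary. Let $X:\Sigma\times[0,T)\to\mathbb R^{n+1}$ be a smooth solution of the $\alpha$-Gauss curvature flow $$\frac{\partial X}{\partial t}(x,t)=-K^\alpha(x,t)\,\nu(x,t),\qquad (x,t)\in\Sigma\times[0,T),$$ such that every $X(\cdot,t)$ is a smooth embedding. Here $\nu$ is the outward unit normal field of $\Sigma_t=X(\Sigma,t)$, continuous in $(x,t)$; in local coordinates $g_{ij}=\langle\partial_iX,\partial_jX\rangle$ and $h_{ij}=-\langle\partial_i\partial_jX,\nu\rangle$; and $K=\det(g^{ik}h_{kj})$ is the Gauss curvature, the product of the principal curvatures. A hypersurface is called strictly convex if $(h_{ij})$ is positive definite at each of its points, i.e. if all its principal curvatures are positive. If $\Sigma_0$ is strictly convex, then $\Sigma_t$ is strictly convex for every $t\in[0,T)$, and $$\inf_{x\in\Sigma}K(x,t)\ \ge\ \inf_{x\in\Sigma}K(x,0)\ >\ 0\qquad\text{for every }t\in[0,T).$$ -/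

import Mathlib

open Set Filter Topology
open scoped Manifold ContDiff

namespace GaussFlow

noncomputable section

section LocalGeometry

variable {n : ℕ} {M : Type*} [TopologicalSpace M] [ChartedSpace (EuclideanSpace ℝ (Fin n)) M]

/-- The map `F : M → ℝⁿ⁺¹` written in the local coordinates `x¹, …, xⁿ` given by the preferred
chart of `M` at `p`. -/
def localRep (F : M → EuclideanSpace ℝ (Fin (n + 1))) (p : M) :
    EuclideanSpace ℝ (Fin n) → EuclideanSpace ℝ (Fin (n + 1)) :=
  fun u => F ((chartAt (EuclideanSpace ℝ (Fin n)) p).symm u)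

/-- The coordinate tangent vector `∂F/∂xⁱ` at `p`. -/
def dX (F : M → EuclideanSpace ℝ (Fin (n + 1))) (p : M) (i : Fin n) :
    EuclideanSpace ℝ (Fin (n + 1)) :=
  fderiv ℝ (localRep F p) (chartAt (EuclideanSpace ℝ (Fin n)) p p) (EuclideanSpace.single i 1)

/-- The second coordinate derivative `∂²F/∂xⁱ∂xʲ` at `p`. -/
def ddX (F : M → EuclideanSpace ℝ (Fin (n + 1))) (p : M) (i j : Fin n) :
    EuclideanSpace ℝ (Fin (n + 1)) :=
  fderiv ℝ (fun u => fderiv ℝ (localRep F p) u (EuclideanSpace.single j 1))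
    (chartAt (EuclideanSpace ℝ (Fin n)) p p) (EuclideanSpace.single i 1)

/-- The induced metric `g_ij = ⟨∂F/∂xⁱ, ∂F/∂xʲ⟩` at `p`. -/
def metric (F : M → EuclideanSpace ℝ (Fin (n + 1))) (p : M) : Matrix (Fin n) (Fin n) ℝ :=
  Matrix.of fun i j => inner ℝ (dX F p i) (dX F p j)

/-- The second fundamental form `h_ij = -⟨∂²F/∂xⁱ∂xʲ, v⟩` at `p`, with respect to the unit
normal vector `v` at `p`. -/
def secondFF (F : M → EuclideanSpace ℝ (Fin (n + 1))) (p : M)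
    (v : EuclideanSpace ℝ (Fin (n + 1))) : Matrix (Fin n) (Fin n) ℝ :=
  Matrix.of fun i j => -inner ℝ (ddX F p i j) v

/-- The matrix `h^i_j = g^{ik} h_{kj}` of the Weingarten map at `p`. -/
def weingarten (F : M → EuclideanSpace ℝ (Fin (n + 1))) (p : M)
    (v : EuclideanSpace ℝ (Fin (n + 1))) : Matrix (Fin n) (Fin n) ℝ :=
  (metric F p)⁻¹ * secondFF F p v

/-- The Gauss curvature `K = det (h^i_j)` at `p`, which does not depend on the chart. -/
def gaussCurvature (F : M → EuclideanSpace ℝ (Fin (n + 1))) (p : M)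
    (v : EuclideanSpace ℝ (Fin (n + 1))) : ℝ :=
  (weingarten F p v).det

/-- `F(M)`, with unit normal field `N`, is strictly convex: the second fundamental form is
positive definite at every point, that is, all principal curvatures are positive. With respect
to the outward normal, round spheres have this property. -/
def IsStrictlyConvex (F N : M → EuclideanSpace ℝ (Fin (n + 1))) : Prop :=
  ∀ p, (secondFF F p (N p)).PosDef

/-- `y` lies outside of the compact hypersurface `S`: it is in an unbounded component of the
complement of `S`. -/
def IsExteriorPoint (S : Set (EuclideanSpace ℝ (Fin (n + 1))))
    (y : EuclideanSpace ℝ (Fin (n + 1))) : Prop :=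
  y ∉ S ∧ ¬ Bornology.IsBounded (connectedComponentIn Sᶜ y)

/-- `y` is enclosed by the compact hypersurface `S`: it is in a bounded component of the
complement of `S`. -/
def IsEnclosedPoint (S : Set (EuclideanSpace ℝ (Fin (n + 1))))
    (y : EuclideanSpace ℝ (Fin (n + 1))) : Prop :=
  y ∉ S ∧ Bornology.IsBounded (connectedComponentIn Sᶜ y)

/-- `v` is the outward unit normal of the embedded hypersurface `F(M)` at `F p`: a unit vector
orthogonal to the hypersurface, pointing from the enclosed region to the exterior. -/
structure IsOutwardUnitNormal (F : M → EuclideanSpace ℝ (Fin (n + 1))) (p : M)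
    (v : EuclideanSpace ℝ (Fin (n + 1))) : Prop where
  norm_eq_one : ‖v‖ = 1
  orthogonal : ∀ i, inner ℝ (dX F p i) v = 0
  exterior : ∀ᶠ s in 𝓝[>] (0 : ℝ), IsExteriorPoint (range F) (F p + s • v)
  enclosed : ∀ᶠ s in 𝓝[>] (0 : ℝ), IsEnclosedPoint (range F) (F p - s • v)

end LocalGeometry

section Flow

variable {n : ℕ} {M : Type*} [TopologicalSpace M] [ChartedSpace (EuclideanSpace ℝ (Fin n)) M]

/-- The Gauss curvature `K(x, t)` of the hypersurface `X(M, t)` with normal `ν(·, t)`. -/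
def curvatureAt (X ν : M → ℝ → EuclideanSpace ℝ (Fin (n + 1))) (x : M) (t : ℝ) : ℝ :=
  gaussCurvature (fun y => X y t) x (ν x t)

/-- `X` is a smooth solution, on the time interval `[0, T)`, of the `α`-Gauss curvature flow
`∂X/∂t = -K^α ν` by embedded hypersurfaces, where `ν` is the outward unit normal field.
(Time derivatives at `t = 0` are one-sided.) -/
structure IsGaussCurvatureFlow (α T : ℝ) (X ν : M → ℝ → EuclideanSpace ℝ (Fin (n + 1))) :
    Prop where
  smooth : ContMDiffOn ((𝓡 n).prod 𝓘(ℝ, ℝ)) (𝓡 (n + 1)) ∞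
    (fun q : M × ℝ => X q.1 q.2) (univ ×ˢ Ico 0 T)
  embedding : ∀ t ∈ Ico 0 T, Manifold.IsSmoothEmbedding (𝓡 n) (𝓡 (n + 1)) ∞ (fun x => X x t)
  normal_continuous : ContinuousOn (fun q : M × ℝ => ν q.1 q.2) (univ ×ˢ Ico 0 T)
  normal : ∀ t ∈ Ico 0 T, ∀ x, IsOutwardUnitNormal (fun y => X y t) x (ν x t)
  evolution : ∀ t ∈ Ico 0 T, ∀ x,
    HasDerivWithinAt (fun s => X x s) (-((curvatureAt X ν x t) ^ α • ν x t)) (Ico 0 T) t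

end Flow

end

end GaussFlow

/-! The argument is a maximum principle for K combined with a continuity argument in time. Suppose
the flow is strictly convex on [0, t₁], and let (p, t) minimise K over M × [0, t₁]. If t > 0, freeze
the value K₀ = K(p, t) and, in the chart at p, consider ψ(s) = det h(s) - K₀ det g(s) = (K(p, s) -
K₀) det g(s). It vanishes at s = t and is nonnegative just before, so ψ'(t) ≤ 0.

On the other hand put f = K^α. Since f is spatially critical at p, ∂ₜg = -2f h and ∂ₜh = D - f h g⁻¹
h, where D is the coordinate Hessian of f; Christoffel terms drop out and D ≥ 0. Jacobi's formula
gives ψ'(t) = det h · (tr(h⁻¹D) + f tr(g⁻¹h)) > 0. The mean curvature term makes this strict, so no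
perturbation is needed. Hence the minimum is attained at t = 0. This is `exists_curvatureAt_lt`,
resting on `trace_adjugate_evolution_pos` and the evolution equations for `IsNormalFlowAt`.

Strict convexity is open in time by compactness. It is also closed: a limit of positive definite h
is positive semidefinite, and the bound K ≥ inf K(·, 0) > 0 passes to the limit and keeps det h
nonzero. So there is no first bad time.

The normal is only assumed continuous. Where K > 0 its smoothness comes from the flow itself: ∂ₜX is
smooth and nonzero, with length K^α and direction -ν (`isNormalFlowAt`). -/

namespace GaussFlow

/-! ### Determinants and traces of positive matrices. -/

section MatrixLemmas

variable {ι : Type*} [Fintype ι] [DecidableEq ι]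

/-- Jacobi's formula for the derivative of a determinant. -/
theorem hasDerivAt_det {A : ℝ → Matrix ι ι ℝ} {A' : Matrix ι ι ℝ} {t : ℝ}
    (h : ∀ i j, HasDerivAt (fun s => A s i j) (A' i j) t) :
    HasDerivAt (fun s => (A s).det) ((A t).adjugate * A').trace t := by
  have hsum : HasDerivAt (fun s => (A s).det)
      (∑ σ : Equiv.Perm ι, (Equiv.Perm.sign σ : ℝ) *
        ∑ i, (∏ j ∈ Finset.univ.erase i, A t (σ j) j) * A' (σ i) i) t := by
    simp only [Matrix.det_apply']
    refine HasDerivAt.fun_sum fun σ _ => ?_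
    refine HasDerivAt.const_mul _ ?_
    have := HasDerivAt.fun_finsetProd (u := Finset.univ)
      (f := fun i s => A s (σ i) i) (f' := fun i => A' (σ i) i) (x := t) (fun i _ => h (σ i) i)
    simpa [smul_eq_mul] using this
  convert hsum using 1
  -- By Cramer's rule each diagonal entry is the determinant with one column differentiated, which
  -- matches the Leibniz expansion in `hsum` term by term.
  have hcol : ∀ i, ((A t).adjugate * A') i i = ((A t).updateCol i (fun k => A' k i)).det := by
    intro i
    rw [← Matrix.cramer_apply, Matrix.cramer_eq_adjugate_mulVec]
    rfl
  simp only [Matrix.trace, Matrix.diag_apply, hcol, Matrix.det_apply', Finset.mul_sum]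
  rw [Finset.sum_comm]
  refine Finset.sum_congr rfl fun σ _ => Finset.sum_congr rfl fun i _ => ?_
  rw [← Finset.mul_prod_erase Finset.univ _ (Finset.mem_univ i), Matrix.updateCol_self]
  rw [mul_comm (A' (σ i) i)]
  congr 2
  refine Finset.prod_congr rfl fun j hj => ?_
  rw [Matrix.updateCol_ne (Finset.ne_of_mem_erase hj)]

-- Factoring A = C*C and cycling the trace leaves the trace of C B C*, which is positive
-- semidefinite.
open scoped MatrixOrder in
theorem trace_mul_nonneg {A B : Matrix ι ι ℝ} (hA : A.PosSemidef) (hB : B.PosSemidef) :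
    0 ≤ (A * B).trace := by
  obtain ⟨C, rfl⟩ := CStarAlgebra.nonneg_iff_eq_star_mul_self.mp hA.nonneg
  rw [Matrix.mul_assoc, Matrix.trace_mul_comm]
  exact (hB.mul_mul_conjTranspose_same C).trace_nonneg

open scoped MatrixOrder in
theorem trace_mul_pos [Nonempty ι] {A B : Matrix ι ι ℝ} (hA : A.PosDef) (hB : B.PosDef) :
    0 < (A * B).trace := by
  obtain ⟨C, hC, rfl⟩ :=
    CStarAlgebra.isStrictlyPositive_iff_eq_star_mul_self.mp hA.isStrictlyPositive
  rw [Matrix.mul_assoc, Matrix.trace_mul_comm]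
  refine (hB.mul_mul_conjTranspose_same ?_).trace_pos
  exact Matrix.vecMul_injective_of_isUnit hC

/-- The reaction terms in the evolution of `det h - K det g` are positive. -/
theorem trace_adjugate_evolution_pos [Nonempty ι] {g h D g' h' : Matrix ι ι ℝ} {f : ℝ}
    (hg : g.PosDef) (hh : h.PosDef) (hD : D.PosSemidef) (hf : 0 < f)
    (hg' : g' = (-2 * f) • h) (hh' : h' = D - f • (h * g⁻¹ * h)) :
    0 < (h.adjugate * h').trace - (g⁻¹ * h).det * (g.adjugate * g').trace := by
  have hgd := hg.det_pos
  have hhd := hh.det_pos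
  have hgu : IsUnit g.det := hgd.ne'.isUnit
  have hhu : IsUnit h.det := hhd.ne'.isUnit
  have adj : ∀ m : Matrix ι ι ℝ, m.det ≠ 0 → m.adjugate = m.det • m⁻¹ := by
    intro m hm
    rw [Matrix.inv_def, smul_smul, Ring.inverse_eq_inv', mul_inv_cancel₀ hm, one_smul]
  have h1 := trace_mul_nonneg hh.inv.posSemidef hD
  have h2 := trace_mul_pos hg.inv hh
  have h3 : h⁻¹ * (h * g⁻¹ * h) = g⁻¹ * h := by
    rw [Matrix.mul_assoc, ← Matrix.mul_assoc, Matrix.nonsing_inv_mul _ hhu, Matrix.one_mul]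
  have hK : (g⁻¹ * h).det * g.det = h.det := by
    rw [Matrix.det_mul, mul_right_comm, ← Matrix.det_mul, Matrix.nonsing_inv_mul _ hgu,
      Matrix.det_one, one_mul]
  rw [adj h hhd.ne', adj g hgd.ne', hg', hh']
  simp only [Matrix.smul_mul, Matrix.mul_sub, Matrix.mul_smul, h3, Matrix.trace_sub,
    Matrix.trace_smul, smul_eq_mul]
  -- The metric contributes +2f tr(g⁻¹h) and the quadratic term of h' contributes -f tr(g⁻¹h), so
  -- one positive copy survives.
  have key : 0 < h.det * ((h⁻¹ * D).trace + f * (g⁻¹ * h).trace) := by positivity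
  linear_combination key - (2 * f * (g⁻¹ * h).trace) * hK

end MatrixLemmas

/-! ### Positivity of matrices under limits. -/

section MatrixLimits

variable {ι : Type*} [Fintype ι]

/-- Positive definiteness is an open condition among symmetric matrices. -/
theorem eventually_posDef {Z : Type*} [TopologicalSpace Z] {l : Filter Z}
    {A : Z → Matrix ι ι ℝ} {A₀ : Matrix ι ι ℝ} (hA : Tendsto A l (𝓝 A₀)) (h0 : A₀.PosDef)
    (hsymm : ∀ᶠ z in l, (A z).IsHermitian) : ∀ᶠ z in l, (A z).PosDef := by
  have hq : Continuous fun q : Matrix ι ι ℝ × (ι → ℝ) => q.2 ⬝ᵥ (q.1.mulVec q.2) := by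
    fun_prop
  have hK : IsCompact (Metric.sphere (0 : ι → ℝ) 1) := isCompact_sphere _ _
  -- Compactness of the unit sphere makes positivity uniform in the vector; homogeneity extends it
  -- to all nonzero vectors.
  have key : ∀ᶠ B in 𝓝 A₀, ∀ v ∈ Metric.sphere (0 : ι → ℝ) 1, 0 < v ⬝ᵥ (B.mulVec v) := by
    refine hK.eventually_forall_of_forall_eventually fun v hv => ?_
    refine hq.continuousAt.eventually (lt_mem_nhds ?_)
    have hv0 : v ≠ 0 := by
      rintro rfl
      simp at hv
    simpa using h0.dotProduct_mulVec_pos hv0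
  filter_upwards [hA.eventually key, hsymm] with z hz hs
  refine Matrix.PosDef.of_dotProduct_mulVec_pos hs fun v hv => ?_
  have hn : 0 < ‖v‖ := norm_pos_iff.mpr hv
  have := hz (‖v‖⁻¹ • v) (by simp [norm_smul, hn.ne'])
  rw [Matrix.mulVec_smul, dotProduct_smul, smul_dotProduct, smul_eq_mul, smul_eq_mul,
    ← mul_assoc] at this
  simpa using pos_of_mul_pos_right this (by positivity)

/-- A limit of positive semidefinite matrices is positive semidefinite. -/
theorem posSemidef_of_tendsto {Z : Type*} {l : Filter Z} [l.NeBot]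
    {A : Z → Matrix ι ι ℝ} {A₀ : Matrix ι ι ℝ} (hA : Tendsto A l (𝓝 A₀))
    (h : ∀ᶠ z in l, (A z).PosSemidef) : A₀.PosSemidef := by
  refine Matrix.PosSemidef.of_dotProduct_mulVec_nonneg ?_ fun v => ?_
  · have h1 : Tendsto (fun z => (A z).conjTranspose) l (𝓝 A₀.conjTranspose) :=
      (Continuous.matrix_conjTranspose continuous_id).continuousAt.tendsto.comp hA
    refine tendsto_nhds_unique (h1.congr' ?_) hA
    filter_upwards [h] with z hz using hz.isHermitian
  · have hq : Continuous fun B : Matrix ι ι ℝ => star v ⬝ᵥ (B.mulVec v) := by fun_prop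
    refine ge_of_tendsto (hq.continuousAt.tendsto.comp hA) ?_
    filter_upwards [h] with z hz using hz.dotProduct_mulVec_nonneg v

end MatrixLimits

/-! ### Differential calculus at a point of space-time. -/

section Germs

variable {P F : Type*} [NormedAddCommGroup P] [NormedSpace ℝ P]
  [NormedAddCommGroup F]

theorem two_le_infty : (2 : WithTop ℕ∞) ≤ ∞ := by
  exact WithTop.coe_le_coe.mpr (le_top : (2 : ℕ∞) ≤ ⊤)

theorem contDiffAt_fderiv_apply [NormedSpace ℝ F] {G : P → F} {p : P} (hG : ContDiffAt ℝ ∞ G p)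
    (w : P) :
    ContDiffAt ℝ ∞ (fun q => fderiv ℝ G q w) p :=
  (hG.fderiv_right (m := ∞) (by simp)).clm_apply contDiffAt_const

theorem fderiv_fderiv_apply [NormedSpace ℝ F] {G : P → F} {p : P} (hG : ContDiffAt ℝ ∞ G p)
    (w z : P) :
    fderiv ℝ (fun q => fderiv ℝ G q w) p z = fderiv ℝ (fderiv ℝ G) p z w := by
  have := (hG.fderiv_right (m := ∞) (by simp)).differentiableAt (by simp)
  rw [fderiv_clm_apply this (by fun_prop)]
  simp

/-- Directional derivatives of a smooth function commute. -/
theorem fderiv_fderiv_comm [NormedSpace ℝ F] {G : P → F} {p : P} (hG : ContDiffAt ℝ ∞ G p)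
    (w z : P) :
    fderiv ℝ (fun q => fderiv ℝ G q w) p z = fderiv ℝ (fun q => fderiv ℝ G q z) p w := by
  rw [fderiv_fderiv_apply hG, fderiv_fderiv_apply hG]
  exact hG.isSymmSndFDerivAt (by simpa using two_le_infty) _ _

/-! ### Necessary conditions at a minimum along lines. -/

section SecondDerivativeTest

variable {f : P → ℝ} {p v : P}

/-- Minimality is required only along one line because the speed is minimal in space at a fixed
time, not in a space-time neighbourhood. -/
theorem fderiv_apply_eq_zero_of_isLocalMin_line (hf : ContDiffAt ℝ ∞ f p)
    (hmin : IsLocalMin (fun s : ℝ => f (p + s • v)) 0) : fderiv ℝ f p v = 0 := by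
  have hl : HasDerivAt (fun s : ℝ => p + s • v) v 0 := by
    simpa using ((hasDerivAt_id (0 : ℝ)).smul_const v).const_add p
  have hd : HasFDerivAt f (fderiv ℝ f p) (p + (0 : ℝ) • v) := by
    simpa using (hf.differentiableAt (by simp)).hasFDerivAt
  exact hmin.hasDerivAt_eq_zero (hd.comp_hasDerivAt (0 : ℝ) hl)

/-- A negative second derivative would make the point a local maximum as well, so the function would
be locally constant on the line and its second derivative zero. -/
theorem fderiv_fderiv_apply_nonneg_of_isLocalMin_line (hf : ContDiffAt ℝ ∞ f p)
    (hmin : IsLocalMin (fun s : ℝ => f (p + s • v)) 0) :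
    0 ≤ fderiv ℝ (fun q => fderiv ℝ f q v) p v := by
  have hl : ∀ s : ℝ, HasDerivAt (fun s : ℝ => p + s • v) v s := fun s => by
    simpa using ((hasDerivAt_id s).smul_const v).const_add p
  have hl0 : Tendsto (fun s : ℝ => p + s • v) (𝓝 0) (𝓝 p) := by
    simpa using (hl 0).continuousAt.tendsto
  have hder : deriv (fun s : ℝ => f (p + s • v)) =ᶠ[𝓝 0] fun s => fderiv ℝ f (p + s • v) v := by
    have := hl0.eventually ((hf.of_le (m := 1) (by simp)).eventually (by simp))
    filter_upwards [this] with s hs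
    exact ((hs.differentiableAt (by simp)).hasFDerivAt.comp_hasDerivAt s (hl s)).deriv
  have hder2 : deriv (deriv (fun s : ℝ => f (p + s • v))) 0
      = fderiv ℝ (fun q => fderiv ℝ f q v) p v := by
    rw [hder.deriv_eq]
    have hd : HasFDerivAt (fun q => fderiv ℝ f q v) (fderiv ℝ (fun q => fderiv ℝ f q v) p)
        (p + (0 : ℝ) • v) := by
      simpa using ((contDiffAt_fderiv_apply hf v).differentiableAt (by simp)).hasFDerivAt
    exact (hd.comp_hasDerivAt (0 : ℝ) (hl 0)).deriv
  by_contra! hneg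
  have hc : ContinuousAt (fun s : ℝ => f (p + s • v)) 0 := by
    refine ContinuousAt.comp (g := f) ?_ (hl 0).continuousAt
    simpa using hf.continuousAt
  have hmax := isLocalMax_of_deriv_deriv_neg (by rwa [hder2]) hmin.deriv_eq_zero hc
  have hconst : (fun s : ℝ => f (p + s • v)) =ᶠ[𝓝 0] fun _ => f (p + (0 : ℝ) • v) := by
    filter_upwards [hmin, hmax] with s h1 h2 using le_antisymm h2 h1
  have hz : deriv (deriv (fun s : ℝ => f (p + s • v))) 0 = 0 := by
    rw [hconst.deriv.deriv_eq]
    simp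
  linarith

/-- The Hessian in the directions `e i` is positive semidefinite at a minimum along the span of
these directions. -/
theorem hessian_posSemidef {ι : Type*} [Fintype ι] {e : ι → P}
    (hf : ContDiffAt ℝ ∞ f p)
    (hmin : ∀ x : ι → ℝ, IsLocalMin (fun s : ℝ => f (p + s • ∑ i, x i • e i)) 0) :
    (Matrix.of fun i j => fderiv ℝ (fun q => fderiv ℝ f q (e j)) p (e i)).PosSemidef := by
  refine Matrix.PosSemidef.of_dotProduct_mulVec_nonneg ?_ fun x => ?_
  · ext i j
    simpa using fderiv_fderiv_comm hf (e i) (e j)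
  · have h := fderiv_fderiv_apply_nonneg_of_isLocalMin_line hf (hmin x)
    rw [fderiv_fderiv_apply hf] at h
    simp only [map_sum, map_smul, sum_apply, smul_apply,
      smul_eq_mul] at h
    simp only [dotProduct, Matrix.mulVec, Matrix.of_apply, fderiv_fderiv_apply hf, star_trivial]
    refine h.trans_eq (Finset.sum_congr rfl fun i _ => ?_)
    rw [Finset.mul_sum, Finset.mul_sum]
    refine Finset.sum_congr rfl fun j _ => ?_
    rw [show fderiv ℝ (fderiv ℝ f) p (e j) (e i) = fderiv ℝ (fderiv ℝ f) p (e i) (e j) from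
      hf.isSymmSndFDerivAt (by simpa using two_le_infty) _ _]
    ring

end SecondDerivativeTest

/-! ### Evolution of the fundamental forms under a normal flow. -/

section Evolution

variable [InnerProductSpace ℝ F]

theorem fderiv_inner_apply' {G H : P → F} {p : P} (hG : ContDiffAt ℝ ∞ G p)
    (hH : ContDiffAt ℝ ∞ H p) (w : P) :
    fderiv ℝ (fun q => inner ℝ (G q) (H q)) p w
      = inner ℝ (G p) (fderiv ℝ H p w) + inner ℝ (fderiv ℝ G p w) (H p) :=
  fderiv_inner_apply ℝ (hG.differentiableAt (by simp)) (hH.differentiableAt (by simp)) w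

theorem fderiv_smul_apply' {f : P → ℝ} {H : P → F} {p : P} (hf : ContDiffAt ℝ ∞ f p)
    (hH : ContDiffAt ℝ ∞ H p) (w : P) :
    fderiv ℝ (fun q => f q • H q) p w = f p • fderiv ℝ H p w + fderiv ℝ f p w • H p := by
  rw [fderiv_fun_smul (hf.differentiableAt (by simp)) (hH.differentiableAt (by simp))]
  simp

variable {ι : Type*} {Y N : P → F} {f : P → ℝ} {p τ : P} {e : ι → P}

/-- A hypersurface family `Y` moving with normal velocity `-f N`, near a point of space-time.
Spatial directions are `e i`, the time direction is `τ`. -/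
structure IsNormalFlowAt (Y N : P → F) (f : P → ℝ) (e : ι → P) (τ p : P) : Prop where
  smooth : ContDiffAt ℝ ∞ Y p
  smooth_normal : ContDiffAt ℝ ∞ N p
  smooth_speed : ContDiffAt ℝ ∞ f p
  flow : (fun q => fderiv ℝ Y q τ) =ᶠ[𝓝 p] fun q => -(f q • N q)
  norm_normal : (fun q => inner ℝ (N q) (N q)) =ᶠ[𝓝 p] fun _ => (1 : ℝ)
  orthogonal : ∀ i, (fun q => inner ℝ (fderiv ℝ Y q (e i)) (N q)) =ᶠ[𝓝 p] fun _ => (0 : ℝ)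
  span : ∀ w, inner ℝ w (N p) = 0 → (∀ i, inner ℝ w (fderiv ℝ Y p (e i)) = 0) → w = 0

namespace IsNormalFlowAt

variable (h : IsNormalFlowAt Y N f e τ p)
include h

theorem inner_fderiv_normal (w : P) : inner ℝ (fderiv ℝ N p w) (N p) = 0 := by
  have := congrArg (fun L : P →L[ℝ] ℝ => L w) h.norm_normal.fderiv_eq
  simp only [fderiv_inner_apply' h.smooth_normal h.smooth_normal, fderiv_fun_const,
    Pi.zero_apply, zero_apply] at this
  rw [real_inner_comm] at this
  linarith [real_inner_comm (N p) (fderiv ℝ N p w)]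

/-- `⟨∂_z N, ∂_i Y⟩ = -⟨N, ∂_z ∂_i Y⟩`. -/
theorem inner_fderiv_normal_tangent (i : ι) (z : P) :
    inner ℝ (fderiv ℝ N p z) (fderiv ℝ Y p (e i))
      = -inner ℝ (fderiv ℝ (fun q => fderiv ℝ Y q (e i)) p z) (N p) := by
  have := congrArg (fun L : P →L[ℝ] ℝ => L z) (h.orthogonal i).fderiv_eq
  simp only [fderiv_inner_apply' (contDiffAt_fderiv_apply h.smooth _) h.smooth_normal,
    fderiv_fun_const, Pi.zero_apply, zero_apply] at this
  rw [real_inner_comm]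
  linarith

/-- Commuting the derivatives reduces this to differentiating the flow equation. An identity of
germs is needed, since `fderiv_secondFF` differentiates it once more in space. -/
theorem fderiv_fderiv_time (i : ι) :
    (fun q => fderiv ℝ (fun r => fderiv ℝ Y r (e i)) q τ)
      =ᶠ[𝓝 p] fun q => -(f q • fderiv ℝ N q (e i) + fderiv ℝ f q (e i) • N q) := by
  have h1 := eventually_eventually_nhds.mpr h.flow
  filter_upwards [h1, (h.smooth.of_le two_le_infty).eventually (by simp),
    (h.smooth_normal.of_le two_le_infty).eventually (by simp),
    (h.smooth_speed.of_le two_le_infty).eventually (by simp)] with q hq hY hN hf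
  have e1 : fderiv ℝ (fun r => fderiv ℝ Y r (e i)) q τ
      = fderiv ℝ (fun r => fderiv ℝ Y r τ) q (e i) := by
    have hd := (hY.fderiv_right (m := 1) (by norm_num)).differentiableAt (by simp)
    rw [fderiv_clm_apply hd (by fun_prop), fderiv_clm_apply hd (by fun_prop)]
    simpa using hY.isSymmSndFDerivAt (by simp) τ (e i)
  have e2 : (fun r => fderiv ℝ Y r τ) =ᶠ[𝓝 q] fun r => -(f r • N r) := hq
  rw [e1, e2.fderiv_eq, fderiv_fun_neg, fderiv_fun_smul (hf.differentiableAt (by simp))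
    (hN.differentiableAt (by simp))]
  simp

theorem fderiv_fderiv_time_self (i : ι) :
    fderiv ℝ (fun r => fderiv ℝ Y r (e i)) p τ
      = -(f p • fderiv ℝ N p (e i) + fderiv ℝ f p (e i) • N p) :=
  (h.fderiv_fderiv_time i).self_of_nhds

theorem orthogonal_self (i : ι) : inner ℝ (fderiv ℝ Y p (e i)) (N p) = 0 :=
  (h.orthogonal i).self_of_nhds

/-- `∂_t g_ij = -2 f h_ij`. -/
theorem fderiv_metric (i j : ι) :
    fderiv ℝ (fun q => inner ℝ (fderiv ℝ Y q (e i)) (fderiv ℝ Y q (e j))) p τ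
      = -2 * f p * -inner ℝ (fderiv ℝ (fun q => fderiv ℝ Y q (e j)) p (e i)) (N p) := by
  have hN := h.orthogonal_self
  rw [fderiv_inner_apply' (contDiffAt_fderiv_apply h.smooth _)
    (contDiffAt_fderiv_apply h.smooth _), h.fderiv_fderiv_time_self,
    h.fderiv_fderiv_time_self]
  simp only [inner_neg_left, inner_neg_right, inner_add_left, inner_add_right,
    inner_smul_left, inner_smul_right, hN, real_inner_comm _ (N p),
    real_inner_comm (fderiv ℝ N p (e j)), h.inner_fderiv_normal_tangent]
  rw [fderiv_fderiv_comm h.smooth (e i) (e j)]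
  simp only [conj_trivial]
  ring

/-- At a critical point of the speed the normal is stationary. -/
theorem fderiv_normal_time (hcrit : ∀ i, fderiv ℝ f p (e i) = 0) : fderiv ℝ N p τ = 0 := by
  refine h.span _ (h.inner_fderiv_normal τ) fun i => ?_
  rw [h.inner_fderiv_normal_tangent, h.fderiv_fderiv_time_self, hcrit]
  simp [inner_smul_left, h.inner_fderiv_normal]

/-- `∂_t h_ij = ∂_i ∂_j f - f ⟨∂_i N, ∂_j N⟩` at a critical point of the speed. -/
theorem fderiv_secondFF (hcrit : ∀ i, fderiv ℝ f p (e i) = 0) (i j : ι) :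
    fderiv ℝ (fun q => -inner ℝ (fderiv ℝ (fun r => fderiv ℝ Y r (e j)) q (e i)) (N q)) p τ
      = fderiv ℝ (fun q => fderiv ℝ f q (e j)) p (e i)
        - f p * inner ℝ (fderiv ℝ N p (e i)) (fderiv ℝ N p (e j)) := by
  have sY := contDiffAt_fderiv_apply h.smooth (e j)
  have sN := contDiffAt_fderiv_apply h.smooth_normal (e j)
  have sf := contDiffAt_fderiv_apply h.smooth_speed (e j)
  -- The normal is stationary, so only the second derivative of Y varies; moving the time derivative
  -- inside turns it into a spatial derivative of `fderiv_fderiv_time`.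
  rw [fderiv_fun_neg, neg_apply,
    fderiv_inner_apply' (contDiffAt_fderiv_apply sY _) h.smooth_normal, h.fderiv_normal_time hcrit,
    inner_zero_right, zero_add, fderiv_fderiv_comm sY, (h.fderiv_fderiv_time j).fderiv_eq,
    fderiv_fun_neg, neg_apply, fderiv_fun_add
      ((h.smooth_speed.differentiableAt (by simp)).fun_smul (sN.differentiableAt (by simp)))
      ((sf.differentiableAt (by simp)).fun_smul (h.smooth_normal.differentiableAt (by simp))),
    add_apply, fderiv_smul_apply' h.smooth_speed sN,
    fderiv_smul_apply' sf h.smooth_normal]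
  have hNN := h.norm_normal.self_of_nhds
  have hNN2 : inner ℝ (fderiv ℝ (fun q => fderiv ℝ N q (e j)) p (e i)) (N p)
      = - inner ℝ (fderiv ℝ N p (e i)) (fderiv ℝ N p (e j)) := by
    -- The derivative of |N|² = 1 vanishes near p, not just at p, so it can be differentiated again.
    have hev : (fun q => inner ℝ (fderiv ℝ N q (e j)) (N q)) =ᶠ[𝓝 p] fun _ => (0 : ℝ) := by
      have h1 := eventually_eventually_nhds.mpr h.norm_normal
      have h2 := (h.smooth_normal.of_le (m := 1) (by simp)).eventually (by simp)
      filter_upwards [h1, h2] with q hq hN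
      have hd := hN.differentiableAt (by simp)
      have e2 : (fun r => inner ℝ (N r) (N r)) =ᶠ[𝓝 q] fun _ => (1 : ℝ) := hq
      have := congrArg (fun L : P →L[ℝ] ℝ => L (e j)) e2.fderiv_eq
      simp only [fderiv_inner_apply ℝ hd hd, fderiv_fun_const,
        Pi.zero_apply, zero_apply] at this
      linarith [real_inner_comm (N q) (fderiv ℝ N q (e j))]
    have := congrArg (fun L : P →L[ℝ] ℝ => L (e i)) hev.fderiv_eq
    simp only [fderiv_inner_apply' sN h.smooth_normal,
      fderiv_fun_const, Pi.zero_apply, zero_apply] at this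
    rw [real_inner_comm (fderiv ℝ N p (e j))]
    linarith
  simp only [hcrit, zero_smul, add_zero, inner_neg_left, inner_add_left, inner_smul_left,
    hNN, hNN2, conj_trivial, mul_one, inner_zero_left]
  ring

variable [Fintype ι] [DecidableEq ι]

/-- The Weingarten equations give `⟨∂_i N, ∂_j N⟩ = (h g⁻¹ h)_ij`. -/
theorem inner_fderiv_normal_fderiv_normal {g b : Matrix ι ι ℝ}
    (hg : g = Matrix.of fun i j => inner ℝ (fderiv ℝ Y p (e i)) (fderiv ℝ Y p (e j)))
    (hb : b = Matrix.of fun i j =>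
      -inner ℝ (fderiv ℝ (fun q => fderiv ℝ Y q (e j)) p (e i)) (N p))
    (hdet : g.det ≠ 0) (i j : ι) :
    inner ℝ (fderiv ℝ N p (e i)) (fderiv ℝ N p (e j)) = (b * g⁻¹ * b) i j := by
  have hbij : ∀ i j, inner ℝ (fderiv ℝ N p (e i)) (fderiv ℝ Y p (e j)) = b i j := by
    intro i j
    rw [h.inner_fderiv_normal_tangent, hb, Matrix.of_apply]
  have hbsymm : ∀ i j, b i j = b j i := by
    intro i j
    rw [hb, Matrix.of_apply, Matrix.of_apply, fderiv_fderiv_comm h.smooth]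
  have hN := h.orthogonal_self
  -- Both sides have the same products with N and with every tangent vector, so `span` identifies
  -- them.
  have hdN : fderiv ℝ N p (e i) = ∑ k, (b * g⁻¹) i k • fderiv ℝ Y p (e k) := by
    rw [← sub_eq_zero]
    refine h.span _ ?_ fun l => ?_
    · simp [inner_sub_left, sum_inner, inner_smul_left, h.inner_fderiv_normal, hN]
    · have : ∑ k, (b * g⁻¹) i k * g k l = b i l := by
        rw [← Matrix.mul_apply, Matrix.mul_assoc, Matrix.nonsing_inv_mul _ hdet.isUnit,
          Matrix.mul_one]
      rw [inner_sub_left, hbij, sum_inner]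
      simp only [inner_smul_left, conj_trivial]
      rw [← this, hg]
      simp
  rw [hdN, sum_inner, Matrix.mul_apply]
  refine Finset.sum_congr rfl fun k _ => ?_
  rw [inner_smul_left, real_inner_comm, hbij, hbsymm j k]
  rfl

end IsNormalFlowAt

end Evolution

end Germs

/-! ### Fundamental forms of a parametrised hypersurface and changes of coordinates. -/

section Coordinates

variable {n : ℕ} {F : Type*} [NormedAddCommGroup F] [InnerProductSpace ℝ F]

/-- The first fundamental form of a parametrised hypersurface `G`. -/
noncomputable def metricAt (G : EuclideanSpace ℝ (Fin n) → F) (u : EuclideanSpace ℝ (Fin n)) :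
    Matrix (Fin n) (Fin n) ℝ :=
  Matrix.of fun i j =>
    inner ℝ (fderiv ℝ G u (EuclideanSpace.single i 1)) (fderiv ℝ G u (EuclideanSpace.single j 1))

/-- The second fundamental form of a parametrised hypersurface `G` with normal vector `v`. -/
noncomputable def secondFFAt (G : EuclideanSpace ℝ (Fin n) → F) (u : EuclideanSpace ℝ (Fin n))
    (v : F) : Matrix (Fin n) (Fin n) ℝ :=
  Matrix.of fun i j =>
    -inner ℝ (fderiv ℝ (fun w => fderiv ℝ G w (EuclideanSpace.single j 1)) u
      (EuclideanSpace.single i 1)) v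

theorem sum_smul_single (w : EuclideanSpace ℝ (Fin n)) :
    ∑ k, w k • EuclideanSpace.single k (1 : ℝ) = w := by
  ext i
  simp [Finset.sum_apply, Pi.single_apply]

theorem map_eq_sum {W : Type*} [NormedAddCommGroup W] [NormedSpace ℝ W]
    (L : EuclideanSpace ℝ (Fin n) →L[ℝ] W) (w : EuclideanSpace ℝ (Fin n)) :
    L w = ∑ k, w k • L (EuclideanSpace.single k 1) := by
  conv_lhs => rw [← sum_smul_single w]
  simp

/-- The Jacobian matrix of a map between Euclidean spaces. -/
noncomputable def jacobian (φ : EuclideanSpace ℝ (Fin n) → EuclideanSpace ℝ (Fin n))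
    (u : EuclideanSpace ℝ (Fin n)) : Matrix (Fin n) (Fin n) ℝ :=
  Matrix.of fun k i => fderiv ℝ φ u (EuclideanSpace.single i 1) k

theorem jacobian_mul_jacobian {φ ψ : EuclideanSpace ℝ (Fin n) → EuclideanSpace ℝ (Fin n)}
    {u : EuclideanSpace ℝ (Fin n)} (hφ : DifferentiableAt ℝ φ u)
    (hψ : DifferentiableAt ℝ ψ (φ u)) (hid : ψ ∘ φ =ᶠ[𝓝 u] id) :
    jacobian ψ (φ u) * jacobian φ u = 1 := by
  have hc : (fderiv ℝ ψ (φ u)).comp (fderiv ℝ φ u) = ContinuousLinearMap.id ℝ _ := by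
    rw [← fderiv_comp u hψ hφ, hid.fderiv_eq, fderiv_id]
  ext i j
  have h1 := congrArg (fun L => L (EuclideanSpace.single j 1) i) hc
  simp only [ContinuousLinearMap.comp_apply, ContinuousLinearMap.id_apply] at h1
  rw [map_eq_sum (fderiv ℝ ψ (φ u))] at h1
  rw [Matrix.mul_apply, Matrix.one_apply]
  simp only [jacobian, Matrix.of_apply]
  simp only [PiLp.single_apply, WithLp.ofLp_sum, Finset.sum_apply, PiLp.smul_apply,
    smul_eq_mul] at h1
  rw [← h1]
  exact Finset.sum_congr rfl fun k _ => mul_comm _ _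

variable {G : EuclideanSpace ℝ (Fin n) → F}
  {φ : EuclideanSpace ℝ (Fin n) → EuclideanSpace ℝ (Fin n)} {u : EuclideanSpace ℝ (Fin n)}

theorem metricAt_comp (hG : DifferentiableAt ℝ G (φ u)) (hφ : DifferentiableAt ℝ φ u) :
    metricAt (G ∘ φ) u = (jacobian φ u).transpose * metricAt G (φ u) * jacobian φ u := by
  ext i j
  simp only [metricAt, Matrix.of_apply, fderiv_comp u hG hφ, ContinuousLinearMap.comp_apply]
  rw [map_eq_sum (fderiv ℝ G (φ u)) (fderiv ℝ φ u (EuclideanSpace.single i 1)),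
    map_eq_sum (fderiv ℝ G (φ u)) (fderiv ℝ φ u (EuclideanSpace.single j 1))]
  simp only [inner_sum, sum_inner, inner_smul_left, inner_smul_right, Matrix.mul_apply,
    Matrix.transpose_apply, jacobian, Matrix.of_apply, Finset.sum_mul, Finset.mul_sum,
    conj_trivial]
  refine Finset.sum_congr rfl fun k _ => Finset.sum_congr rfl fun l _ => by ring

/-- The second derivative of φ enters only through a tangent vector of G, which is orthogonal to v;
what remains transforms as a bilinear form. -/
theorem secondFFAt_comp (hG : ContDiffAt ℝ ∞ G (φ u)) (hφ : ContDiffAt ℝ ∞ φ u) {v : F}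
    (hv : ∀ w, inner ℝ (fderiv ℝ G (φ u) w) v = 0) :
    secondFFAt (G ∘ φ) u v
      = (jacobian φ u).transpose * secondFFAt G (φ u) v * jacobian φ u := by
  ext i j
  have hev : (fun w => fderiv ℝ (G ∘ φ) w (EuclideanSpace.single j 1)) =ᶠ[𝓝 u]
      fun w => fderiv ℝ G (φ w) (fderiv ℝ φ w (EuclideanSpace.single j 1)) := by
    have h1 := hφ.continuousAt.eventually ((hG.of_le (m := 1) (by simp)).eventually (by simp))
    have h2 := (hφ.of_le (m := 1) (by simp)).eventually (by simp)
    filter_upwards [h1, h2] with w hw1 hw2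
    rw [fderiv_comp w (hw1.differentiableAt (by simp)) (hw2.differentiableAt (by simp))]
    rfl
  have hdG : DifferentiableAt ℝ (fderiv ℝ G) (φ u) :=
    (hG.fderiv_right (m := ∞) (by simp)).differentiableAt (by simp)
  have hdφ := (contDiffAt_fderiv_apply hφ (EuclideanSpace.single j 1)).differentiableAt
    (by simp)
  have hφd := hφ.differentiableAt (by simp)
  have key : inner ℝ (fderiv ℝ (fun w => fderiv ℝ (G ∘ φ) w (EuclideanSpace.single j 1)) u
      (EuclideanSpace.single i 1)) v
      = inner ℝ (fderiv ℝ (fderiv ℝ G) (φ u) (fderiv ℝ φ u (EuclideanSpace.single i 1))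
        (fderiv ℝ φ u (EuclideanSpace.single j 1))) v := by
    have hc : DifferentiableAt ℝ (fun w => fderiv ℝ G (φ w)) u := hdG.comp u hφd
    rw [hev.fderiv_eq, fderiv_clm_apply hc hdφ]
    have : fderiv ℝ (fun w => fderiv ℝ G (φ w)) u = (fderiv ℝ (fderiv ℝ G) (φ u)).comp
        (fderiv ℝ φ u) := fderiv_comp u hdG hφd
    simp [this, inner_add_left, hv]
  simp only [secondFFAt, Matrix.of_apply]
  rw [key, map_eq_sum (fderiv ℝ (fderiv ℝ G) (φ u)) (fderiv ℝ φ u (EuclideanSpace.single i 1))]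
  simp only [sum_apply, smul_apply]
  simp only [map_eq_sum (fderiv ℝ (fderiv ℝ G) (φ u) _)
    (fderiv ℝ φ u (EuclideanSpace.single j 1))]
  simp only [sum_inner, inner_smul_left, Matrix.mul_apply, fderiv_fderiv_apply hG,
    Matrix.transpose_apply, jacobian, Matrix.of_apply, Finset.sum_mul, Finset.mul_sum,
    conj_trivial, ← Finset.sum_neg_distrib]
  rw [Finset.sum_comm]
  refine Finset.sum_congr rfl fun l _ => Finset.sum_congr rfl fun k _ => ?_
  ring

theorem secondFFAt_isHermitian (hG : ContDiffAt ℝ ∞ G u) (v : F) :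
    (secondFFAt G u v).IsHermitian := by
  ext i j
  simp only [secondFFAt, Matrix.conjTranspose_apply, Matrix.of_apply, star_trivial]
  rw [fderiv_fderiv_comm hG]

/-- This is a Gram matrix: its quadratic form at x is the squared length of the image of x under an
injective differential. -/
theorem metricAt_posDef (hinj : Function.Injective (fderiv ℝ G u)) : (metricAt G u).PosDef := by
  refine Matrix.PosDef.of_dotProduct_mulVec_pos ?_ fun x hx => ?_
  · ext i j
    simp [metricAt, real_inner_comm]
  · have h0 : fderiv ℝ G u (WithLp.toLp 2 x) ≠ 0 := by
      intro h
      have := hinj (h.trans (map_zero _).symm)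
      exact hx (by simpa using this)
    have h1 : 0 < inner ℝ (fderiv ℝ G u (WithLp.toLp 2 x)) (fderiv ℝ G u (WithLp.toLp 2 x)) :=
      real_inner_self_pos.mpr h0
    rw [map_eq_sum] at h1
    refine h1.trans_eq ?_
    simp only [inner_sum, sum_inner, inner_smul_left, inner_smul_right, conj_trivial, dotProduct,
      Matrix.mulVec, metricAt, Matrix.of_apply, star_trivial, Finset.mul_sum]
    rw [Finset.sum_comm]
    refine Finset.sum_congr rfl fun k _ => Finset.sum_congr rfl fun l _ => by ring

/-- A vector orthogonal to the normal and to all coordinate tangent vectors vanishes. -/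
theorem eq_zero_of_inner_normal_of_inner_tangent
    {L : EuclideanSpace ℝ (Fin n) →L[ℝ] EuclideanSpace ℝ (Fin (n + 1))}
    (hinj : Function.Injective L) {v w : EuclideanSpace ℝ (Fin (n + 1))} (hv : v ≠ 0)
    (hLv : ∀ x, inner ℝ (L x) v = 0) (hw : inner ℝ w v = 0)
    (hLw : ∀ x, inner ℝ w (L x) = 0) : w = 0 := by
  set S := LinearMap.range L.toLinearMap with hS
  have hSr : Module.finrank ℝ S = n := by
    rw [hS, LinearMap.finrank_range_of_inj (f := L.toLinearMap) hinj]
    simp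
  -- In codimension one the normal line is spanned by v, so w is a multiple of v and also orthogonal
  -- to it.
  have hperp : Module.finrank ℝ Sᗮ = 1 := by
    have := S.finrank_add_finrank_orthogonal
    rw [hSr, finrank_euclideanSpace_fin] at this
    omega
  have hvS : v ∈ Sᗮ := by
    rw [Submodule.mem_orthogonal]
    rintro _ ⟨x, rfl⟩
    exact hLv x
  have hwS : w ∈ Sᗮ := by
    rw [Submodule.mem_orthogonal]
    rintro _ ⟨x, rfl⟩
    rw [real_inner_comm]
    exact hLw x
  obtain ⟨c, hc⟩ := (finrank_eq_one_iff_of_nonzero' (⟨v, hvS⟩ : Sᗮ)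
    (by simpa [Subtype.ext_iff] using hv)).mp hperp ⟨w, hwS⟩
  have hcw : c • v = w := congrArg Subtype.val hc
  have : inner ℝ w w = (0 : ℝ) := by
    nth_rewrite 2 [← hcw]
    rw [inner_smul_right, hw, mul_zero]
  exact inner_self_eq_zero.mp this

end Coordinates

/-! ### Spatial derivatives up to the boundary of the time interval. -/

section ProductSmooth

variable {E F : Type*} [NormedAddCommGroup E] [NormedSpace ℝ E] [NormedAddCommGroup F]
  [NormedSpace ℝ F]

/-- The set I need not be open, so at an initial time only the derivative within V × I is available;
openness of V still gives a full derivative in space. -/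
theorem fderiv_slice_eq_fderivWithin {G : E × ℝ → F} {V : Set E} {I : Set ℝ} (hV : IsOpen V)
    (hG : ContDiffOn ℝ ∞ G (V ×ˢ I)) {u : E} (hu : u ∈ V) {t : ℝ} (ht : t ∈ I) (e : E) :
    fderiv ℝ (fun w => G (w, t)) u e = fderivWithin ℝ G (V ×ˢ I) (u, t) (e, 0) := by
  have h1 := ((hG.differentiableOn (by simp)) (u, t) ⟨hu, ht⟩).hasFDerivWithinAt
  have h2 : HasFDerivWithinAt (fun w : E => (w, t)) (ContinuousLinearMap.inl ℝ E ℝ) V u :=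
    (hasFDerivAt_prodMk_left u t).hasFDerivWithinAt
  have h3 := (h1.comp u h2 (fun w hw => Set.mk_mem_prod hw ht)).hasFDerivAt (hV.mem_nhds hu)
  have h4 : fderiv ℝ (fun w => G (w, t)) u = _ := h3.fderiv
  rw [h4]
  rfl

/-- Spatial derivatives of a function smooth in space-time are smooth in space-time. -/
theorem contDiffOn_fderiv_slice {G : E × ℝ → F} {V : Set E} {I : Set ℝ} (hV : IsOpen V)
    (hI : UniqueDiffOn ℝ I) (hG : ContDiffOn ℝ ∞ G (V ×ˢ I)) (e : E) :
    ContDiffOn ℝ ∞ (fun q : E × ℝ => fderiv ℝ (fun w => G (w, q.2)) q.1 e) (V ×ˢ I) := by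
  have h := (hG.fderivWithin (m := ∞) (hV.uniqueDiffOn.prod hI) (by simp)).clm_apply
    (contDiffOn_const (c := ((e, 0) : E × ℝ)))
  exact h.congr fun q hq => fderiv_slice_eq_fderivWithin hV hG hq.1 hq.2 e

end ProductSmooth

/-! ### Independence of the chart. -/

section Charts

variable {n : ℕ} {M : Type*} [TopologicalSpace M] [ChartedSpace (EuclideanSpace ℝ (Fin n)) M]
  {F : M → EuclideanSpace ℝ (Fin (n + 1))}

theorem metric_eq (F : M → EuclideanSpace ℝ (Fin (n + 1))) (p : M) :
    metric F p = metricAt (localRep F p) (chartAt (EuclideanSpace ℝ (Fin n)) p p) := rfl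

theorem secondFF_eq (F : M → EuclideanSpace ℝ (Fin (n + 1))) (p : M)
    (v : EuclideanSpace ℝ (Fin (n + 1))) :
    secondFF F p v = secondFFAt (localRep F p) (chartAt (EuclideanSpace ℝ (Fin n)) p p) v := rfl

/-- The maximal atlas is used because the charts in the normal form of an immersion need not be
preferred charts. -/
theorem contDiffAt_transition {c d : OpenPartialHomeomorph M (EuclideanSpace ℝ (Fin n))}
    (hc : c ∈ IsManifold.maximalAtlas (𝓡 n) ∞ M) (hd : d ∈ IsManifold.maximalAtlas (𝓡 n) ∞ M)
    {q : M} (hqc : q ∈ c.source) (hqd : q ∈ d.source) : ContDiffAt ℝ ∞ (d ∘ c.symm) (c q) := by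
  rw [← contMDiffAt_iff_contDiffAt]
  refine ContMDiffAt.comp (I' := 𝓡 n) (c q) ?_
    (contMDiffAt_symm_of_mem_maximalAtlas hc (c.map_source hqc))
  rw [c.left_inv hqc]
  exact contMDiffAt_of_mem_maximalAtlas hd hqd

variable [IsManifold (𝓡 n) ∞ M]

theorem contDiffAt_localRep (hF : ContMDiff (𝓡 n) (𝓡 (n + 1)) ∞ F) {p : M}
    {u : EuclideanSpace ℝ (Fin n)} (hu : u ∈ (chartAt (EuclideanSpace ℝ (Fin n)) p).target) :
    ContDiffAt ℝ ∞ (localRep F p) u := by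
  rw [← contMDiffAt_iff_contDiffAt]
  exact hF.contMDiffAt.comp (I' := 𝓡 n) u
    (contMDiffAt_symm_of_mem_maximalAtlas (IsManifold.chart_mem_maximalAtlas p) hu)

/-- The normal form of an immersion supplies a differentiable local left inverse, and the chain rule
then gives a left inverse of the differential. -/
theorem fderiv_localRep_injective
    (hF : Manifold.IsImmersion (𝓡 n) (𝓡 (n + 1)) ∞ F) (p : M) {u : EuclideanSpace ℝ (Fin n)}
    (hu : u ∈ (chartAt (EuclideanSpace ℝ (Fin n)) p).target) :
    Function.Injective (fderiv ℝ (localRep F p) u) := by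
  set c := chartAt (EuclideanSpace ℝ (Fin n)) p with hc
  set q := c.symm u with hq
  have hqc : q ∈ c.source := c.map_target hu
  have hcq : c q = u := c.right_inv hu
  have h := hF.isImmersionAt q
  set d := h.domChart
  set k := h.codChart
  have hqd : q ∈ d.source := h.mem_domChart_source
  have hqk : F q ∈ k.source := h.mem_codChart_source
  have hd : d ∈ IsManifold.maximalAtlas (𝓡 n) ∞ M := h.domChart_mem_maximalAtlas
  have hcM : c ∈ IsManifold.maximalAtlas (𝓡 n) ∞ M := IsManifold.chart_mem_maximalAtlas p
  have hk : ContDiffAt ℝ ∞ k (F q) := by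
    rw [← contMDiffAt_iff_contDiffAt]
    exact contMDiffAt_of_mem_maximalAtlas h.codChart_mem_maximalAtlas hqk
  have hw : ∀ x ∈ d.source, k (F x) = h.equiv (d x, 0) := by
    intro x hx
    have := h.writtenInCharts (show d x ∈ (d.extend (𝓡 n)).target by
      simpa using d.map_source hx)
    change k (F (d.symm (d x))) = h.equiv (d x, 0) at this
    rwa [d.left_inv hx] at this
  have hfst : ∀ x ∈ d.source, (h.equiv.symm (k (F x))).1 = d x := by
    intro x hx
    simp [hw x hx]
  have hY : DifferentiableAt ℝ (localRep F p) u :=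
    (contDiffAt_localRep hF.contMDiff hu).differentiableAt (by simp)
  -- The left inverse: pass to the codomain chart, project to the first factor of the normal form,
  -- and change from the immersion chart d to c.
  set R : EuclideanSpace ℝ (Fin (n + 1)) → EuclideanSpace ℝ (Fin n) :=
    fun y => (c ∘ d.symm) (h.equiv.symm (k y)).1 with hR
  have hYu : localRep F p u = F q := rfl
  have hRd : DifferentiableAt ℝ R (localRep F p u) := by
    rw [hYu]
    have h1 : DifferentiableAt ℝ (fun y => (h.equiv.symm (k y)).1) (F q) :=
      differentiableAt_fst.comp (F q)
        (h.equiv.symm.differentiableAt.comp (F q) (hk.differentiableAt (by simp)))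
    have h2 : DifferentiableAt ℝ (c ∘ d.symm) (h.equiv.symm (k (F q))).1 := by
      rw [hfst q hqd]
      exact (contDiffAt_transition hd hcM hqd hqc).differentiableAt (by simp)
    exact DifferentiableAt.comp (g := c ∘ d.symm) (F q) h2 h1
  have hid : R ∘ localRep F p =ᶠ[𝓝 u] id := by
    have hcont : ContinuousAt c.symm u := c.symm.continuousAt hu
    filter_upwards [hcont.preimage_mem_nhds (d.open_source.mem_nhds hqd),
      c.open_target.mem_nhds hu] with w hw1 hw2
    have hw1' : c.symm w ∈ d.source := hw1
    change c (d.symm (h.equiv.symm (k (F (c.symm w)))).1) = w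
    rw [hfst _ hw1', d.left_inv hw1', c.right_inv hw2]
  have hcomp : (fderiv ℝ R (localRep F p u)).comp (fderiv ℝ (localRep F p) u)
      = ContinuousLinearMap.id ℝ _ := by
    rw [← fderiv_comp u hRd hY, hid.fderiv_eq, fderiv_id]
  intro x y hxy
  have := congrArg (fun L => L x) hcomp
  have h' := congrArg (fun L => L y) hcomp
  simp only [ContinuousLinearMap.comp_apply, ContinuousLinearMap.id_apply] at this h'
  rw [← this, ← h', hxy]

/-- Change of charts: the fundamental forms at `q` are congruent to the ones computed in the chart
at `p`. -/
theorem exists_jacobian (hF : ContMDiff (𝓡 n) (𝓡 (n + 1)) ∞ F) {p q : M}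
    (hq : q ∈ (chartAt (EuclideanSpace ℝ (Fin n)) p).source)
    {v : EuclideanSpace ℝ (Fin (n + 1))} (hv : ∀ i, inner ℝ (dX F q i) v = 0) :
    (∀ w, inner ℝ (fderiv ℝ (localRep F p) (chartAt (EuclideanSpace ℝ (Fin n)) p q) w) v = 0) ∧
    ∃ J : Matrix (Fin n) (Fin n) ℝ, IsUnit J ∧
      metric F q = J.transpose *
        metricAt (localRep F p) (chartAt (EuclideanSpace ℝ (Fin n)) p q) * J ∧
      secondFF F q v = J.transpose *
        secondFFAt (localRep F p) (chartAt (EuclideanSpace ℝ (Fin n)) p q) v * J := by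
  set c := chartAt (EuclideanSpace ℝ (Fin n)) p with hc
  set d := chartAt (EuclideanSpace ℝ (Fin n)) q with hd
  have hqd : q ∈ d.source := mem_chart_source _ q
  have hcM : c ∈ IsManifold.maximalAtlas (𝓡 n) ∞ M := IsManifold.chart_mem_maximalAtlas p
  have hdM : d ∈ IsManifold.maximalAtlas (𝓡 n) ∞ M := IsManifold.chart_mem_maximalAtlas q
  have hφ := contDiffAt_transition hdM hcM hqd hq
  have hψ := contDiffAt_transition hcM hdM hq hqd
  set φ := c ∘ d.symm with hφdef
  set ψ := d ∘ c.symm with hψdef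
  have hφq : φ (d q) = c q := by simp [hφdef, d.left_inv hqd]
  have hψq : ψ (c q) = d q := by simp [hψdef, c.left_inv hq]
  have hid : ∀ {a b : OpenPartialHomeomorph M (EuclideanSpace ℝ (Fin n))}, q ∈ a.source →
      q ∈ b.source → (b ∘ a.symm) ∘ (a ∘ b.symm) =ᶠ[𝓝 (b q)] id := by
    intro a b ha hb
    have hcont := b.symm.continuousAt (b.map_source hb)
    have hmem : a.source ∈ 𝓝 (b.symm (b q)) := by
      rw [b.left_inv hb]
      exact a.open_source.mem_nhds ha
    filter_upwards [hcont.preimage_mem_nhds hmem,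
      b.open_target.mem_nhds (b.map_source hb)] with w hw1 hw2
    have hw1' : b.symm w ∈ a.source := hw1
    simp [a.left_inv hw1', b.right_inv hw2]
  have hG : ContDiffAt ℝ ∞ (localRep F p) (φ (d q)) := by
    rw [hφq]
    exact contDiffAt_localRep hF (c.map_source hq)
  have hrep : localRep F q =ᶠ[𝓝 (d q)] localRep F p ∘ φ := by
    have hcont := d.symm.continuousAt (d.map_source hqd)
    have hmem : c.source ∈ 𝓝 (d.symm (d q)) := by
      rw [d.left_inv hqd]
      exact c.open_source.mem_nhds hq
    filter_upwards [hcont.preimage_mem_nhds hmem] with w hw1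
    have hw1' : d.symm w ∈ c.source := hw1
    change F (d.symm w) = F (c.symm (c (d.symm w)))
    rw [c.left_inv hw1']
  have hJ : jacobian ψ (φ (d q)) * jacobian φ (d q) = 1 :=
    jacobian_mul_jacobian (hφ.differentiableAt (by simp))
      (by rw [hφq]; exact hψ.differentiableAt (by simp)) (hid hq hqd)
  have hcomp : (fderiv ℝ φ (d q)).comp (fderiv ℝ ψ (c q)) = ContinuousLinearMap.id ℝ _ := by
    have hφ' : DifferentiableAt ℝ φ (ψ (c q)) := by
      rw [hψq]
      exact hφ.differentiableAt (by simp)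
    have := fderiv_comp (c q) hφ' (hψ.differentiableAt (by simp))
    rw [hψq] at this
    rw [← this, (hid hqd hq).fderiv_eq, fderiv_id]
  have horth : ∀ w, inner ℝ (fderiv ℝ (localRep F p) (c q) w) v = 0 := by
    intro w
    have h1 : ∀ x, inner ℝ (fderiv ℝ (localRep F q) (d q) x) v = 0 := by
      intro x
      rw [map_eq_sum (fderiv ℝ (localRep F q) (d q)), sum_inner]
      refine Finset.sum_eq_zero fun i _ => ?_
      rw [inner_smul_left]
      have := hv i
      rw [dX] at this
      rw [this, mul_zero]
    have h2 := h1 (fderiv ℝ ψ (c q) w)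
    rw [hrep.fderiv_eq, fderiv_comp (d q) (hG.differentiableAt (by simp))
      (hφ.differentiableAt (by simp)), ContinuousLinearMap.comp_apply,
      ← ContinuousLinearMap.comp_apply (fderiv ℝ φ (d q)), hcomp, hφq] at h2
    exact h2
  refine ⟨horth, jacobian φ (d q), IsUnit.of_mul_eq_one_right _ hJ, ?_, ?_⟩
  · have h1 := metricAt_comp (hG.differentiableAt (by simp)) (hφ.differentiableAt (by simp))
    rw [hφq] at h1
    rw [← h1, metric_eq]
    simp only [metricAt, ← hd, hrep.fderiv_eq]
  · have h1 := secondFFAt_comp hG hφ (v := v) (by rw [hφq]; exact horth)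
    rw [hφq] at h1
    rw [← h1, secondFF_eq]
    have h2 : ∀ j : Fin n, (fun w => fderiv ℝ (localRep F q) w (EuclideanSpace.single j 1))
        =ᶠ[𝓝 (d q)] fun w => fderiv ℝ (localRep F p ∘ φ) w (EuclideanSpace.single j 1) := by
      intro j
      filter_upwards [hrep.fderiv (𝕜 := ℝ)] with w hw
      rw [hw]
    simp only [secondFFAt, ← hd, (h2 _).fderiv_eq]

theorem secondFF_posDef_iff (hF : ContMDiff (𝓡 n) (𝓡 (n + 1)) ∞ F) {p q : M}
    (hq : q ∈ (chartAt (EuclideanSpace ℝ (Fin n)) p).source)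
    {v : EuclideanSpace ℝ (Fin (n + 1))} (hv : ∀ i, inner ℝ (dX F q i) v = 0) :
    (secondFF F q v).PosDef ↔
      (secondFFAt (localRep F p) (chartAt (EuclideanSpace ℝ (Fin n)) p q) v).PosDef := by
  obtain ⟨-, J, hJ, -, hb⟩ := exists_jacobian hF hq hv
  rw [hb]
  exact Matrix.IsUnit.posDef_star_left_conjugate_iff hJ

/-- Both determinants acquire the factor (det J)², which cancels. This lets K be followed in one
fixed chart although it is defined pointwise in varying preferred charts. -/
theorem gaussCurvature_eq_det_div_det (hF : ContMDiff (𝓡 n) (𝓡 (n + 1)) ∞ F) {p q : M}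
    (hq : q ∈ (chartAt (EuclideanSpace ℝ (Fin n)) p).source)
    {v : EuclideanSpace ℝ (Fin (n + 1))} (hv : ∀ i, inner ℝ (dX F q i) v = 0) :
    gaussCurvature F q v =
      (secondFFAt (localRep F p) (chartAt (EuclideanSpace ℝ (Fin n)) p q) v).det /
        (metricAt (localRep F p) (chartAt (EuclideanSpace ℝ (Fin n)) p q)).det := by
  obtain ⟨-, J, hJ, hg, hb⟩ := exists_jacobian hF hq hv
  have hJd : J.det ≠ 0 := ((Matrix.isUnit_iff_isUnit_det _).mp hJ).ne_zero
  rw [gaussCurvature, weingarten, Matrix.det_mul, Matrix.det_nonsing_inv, hg, hb]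
  simp only [Matrix.det_mul, Matrix.det_transpose, Ring.inverse_eq_inv']
  rw [inv_mul_eq_div]
  set a := (metricAt (localRep F p) (chartAt (EuclideanSpace ℝ (Fin n)) p q)).det
  rw [mul_right_comm, mul_right_comm _ a, mul_div_mul_left _ _ (mul_ne_zero hJd hJd)]

end Charts

/-! ### Slices of space-time functions and one-sided derivative tests. -/

section Slices

variable {E F : Type*} [NormedAddCommGroup E] [NormedSpace ℝ E] [NormedAddCommGroup F]
  [NormedSpace ℝ F]

theorem fderiv_slice {G : E × ℝ → F} {q : E × ℝ} (hG : DifferentiableAt ℝ G q) (e : E) :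
    fderiv ℝ (fun w => G (w, q.2)) q.1 e = fderiv ℝ G q (e, 0) := by
  have h2 : HasFDerivAt (fun w : E => (w, q.2)) (ContinuousLinearMap.inl ℝ E ℝ) q.1 :=
    hasFDerivAt_prodMk_left q.1 q.2
  have h3 : fderiv ℝ (fun w => G (w, q.2)) q.1 = _ :=
    (HasFDerivAt.comp (g := G) q.1 hG.hasFDerivAt h2).fderiv
  rw [h3]
  rfl

theorem fderiv_fderiv_slice {G : E × ℝ → F} {q : E × ℝ} (hG : ContDiffAt ℝ ∞ G q) (e e' : E) :
    fderiv ℝ (fun w => fderiv ℝ (fun w' => G (w', q.2)) w e) q.1 e'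
      = fderiv ℝ (fun r => fderiv ℝ G r (e, 0)) q (e', 0) := by
  have hc : ContinuousAt (fun w : E => (w, q.2)) q.1 := by fun_prop
  have hev : (fun w => fderiv ℝ (fun w' => G (w', q.2)) w e)
      =ᶠ[𝓝 q.1] fun w => fderiv ℝ G (w, q.2) (e, 0) := by
    have := hc.eventually ((hG.of_le (m := 1) (by simp)).eventually (by simp))
    filter_upwards [this] with w hw
    exact fderiv_slice (q := (w, q.2)) (hw.differentiableAt (by simp)) e
  rw [hev.fderiv_eq]
  exact fderiv_slice (G := fun r => fderiv ℝ G r (e, 0))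
    ((contDiffAt_fderiv_apply hG _).differentiableAt (by simp)) e'

theorem hasDerivAt_time_line {G : E × ℝ → F} {u : E} {t : ℝ}
    (hG : DifferentiableAt ℝ G (u, t)) :
    HasDerivAt (fun s => G (u, s)) (fderiv ℝ G (u, t) (0, 1)) t := by
  have h2 : HasDerivAt (fun s : ℝ => (u, s)) ((0 : E), (1 : ℝ)) t :=
    (hasDerivAt_const t u).prodMk (hasDerivAt_id t)
  exact HasFDerivAt.comp_hasDerivAt (l := G) t hG.hasFDerivAt h2

theorem nonpos_of_hasDerivAt_of_le_left {ψ : ℝ → ℝ} {ψ' t : ℝ} (h : HasDerivAt ψ ψ' t)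
    (hle : ∀ᶠ s in 𝓝[<] t, ψ t ≤ ψ s) : ψ' ≤ 0 := by
  have h1 := (hasDerivWithinAt_iff_tendsto_slope' (s := Iio t) (by simp)).mp
    h.hasDerivWithinAt
  refine le_of_tendsto h1 ?_
  filter_upwards [hle, self_mem_nhdsWithin] with s hs hst
  rw [slope_def_field]
  exact div_nonpos_of_nonneg_of_nonpos (by linarith) (by simpa using le_of_lt hst)

end Slices

/-! ### Regularity of the flow and openness of strict convexity. -/

section Flow

variable {n : ℕ} {M : Type*} [TopologicalSpace M] [ChartedSpace (EuclideanSpace ℝ (Fin n)) M]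
  {α T : ℝ} {X ν : M → ℝ → EuclideanSpace ℝ (Fin (n + 1))}

/-- The flow in the chart at `p`, as a map on space-time. -/
noncomputable def spaceTimeRep (X : M → ℝ → EuclideanSpace ℝ (Fin (n + 1))) (p : M) :
    EuclideanSpace ℝ (Fin n) × ℝ → EuclideanSpace ℝ (Fin (n + 1)) :=
  fun q => X ((chartAt (EuclideanSpace ℝ (Fin n)) p).symm q.1) q.2

theorem IsGaussCurvatureFlow.contMDiff_slice (hX : IsGaussCurvatureFlow α T X ν) {t : ℝ} (ht : t ∈ Ico 0 T) :
    ContMDiff (𝓡 n) (𝓡 (n + 1)) ∞ (fun x => X x t) :=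
  (hX.embedding t ht).contMDiff

variable [IsManifold (𝓡 n) ∞ M]

namespace IsGaussCurvatureFlow

theorem contDiffOn_spaceTimeRep (hX : IsGaussCurvatureFlow α T X ν) (p : M) :
    ContDiffOn ℝ ∞ (spaceTimeRep X p)
      ((chartAt (EuclideanSpace ℝ (Fin n)) p).target ×ˢ Ico 0 T) := by
  set c := chartAt (EuclideanSpace ℝ (Fin n)) p with hc
  rw [← contMDiffOn_iff_contDiffOn]
  have h1 : ContMDiffOn 𝓘(ℝ, EuclideanSpace ℝ (Fin n) × ℝ) (𝓡 n) ∞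
      (fun q : EuclideanSpace ℝ (Fin n) × ℝ => c.symm q.1) (c.target ×ˢ Ico 0 T) :=
    (contMDiffOn_symm_of_mem_maximalAtlas (IsManifold.chart_mem_maximalAtlas p)).comp
      (contDiff_fst.contMDiff.contMDiffOn) fun q hq => hq.1
  have h2 : ContMDiffOn 𝓘(ℝ, EuclideanSpace ℝ (Fin n) × ℝ) 𝓘(ℝ, ℝ) ∞
      (fun q : EuclideanSpace ℝ (Fin n) × ℝ => q.2) (c.target ×ˢ Ico 0 T) :=
    contDiff_snd.contMDiff.contMDiffOn
  exact hX.smooth.comp (h1.prodMk h2) fun q hq => ⟨mem_univ _, hq.2⟩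

theorem contDiffAt_spaceTimeRep (hX : IsGaussCurvatureFlow α T X ν) (p : M)
    {q : EuclideanSpace ℝ (Fin n) × ℝ}
    (hq : q ∈ (chartAt (EuclideanSpace ℝ (Fin n)) p).target ×ˢ Ioo 0 T) :
    ContDiffAt ℝ ∞ (spaceTimeRep X p) q := by
  refine (hX.contDiffOn_spaceTimeRep p).contDiffAt ?_
  refine mem_of_superset (((chartAt (EuclideanSpace ℝ (Fin n)) p).open_target.prod
    isOpen_Ioo).mem_nhds hq) ?_
  exact prod_mono_right Ioo_subset_Ico_self

/-- The time derivative of the flow in a chart. -/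
theorem fderiv_spaceTimeRep_time (hX : IsGaussCurvatureFlow α T X ν) (p : M)
    {q : EuclideanSpace ℝ (Fin n) × ℝ}
    (hq : q ∈ (chartAt (EuclideanSpace ℝ (Fin n)) p).target ×ˢ Ioo 0 T) :
    fderiv ℝ (spaceTimeRep X p) q (0, 1) =
      -((curvatureAt X ν ((chartAt (EuclideanSpace ℝ (Fin n)) p).symm q.1) q.2) ^ α •
        ν ((chartAt (EuclideanSpace ℝ (Fin n)) p).symm q.1) q.2) := by
  have h1 := hasDerivAt_time_line (G := spaceTimeRep X p) (u := q.1) (t := q.2)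
    ((hX.contDiffAt_spaceTimeRep p hq).differentiableAt (by simp))
  have h2 := (hX.evolution q.2 (Ioo_subset_Ico_self hq.2)
    ((chartAt (EuclideanSpace ℝ (Fin n)) p).symm q.1)).hasDerivAt (Ico_mem_nhds hq.2.1 hq.2.2)
  exact h1.unique h2

theorem continuousOn_metricAt (hX : IsGaussCurvatureFlow α T X ν) (p : M) :
    ContinuousOn (fun q : M × ℝ => metricAt (localRep (fun x => X x q.2) p)
      (chartAt (EuclideanSpace ℝ (Fin n)) p q.1))
      ((chartAt (EuclideanSpace ℝ (Fin n)) p).source ×ˢ Ico 0 T) := by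
  set c := chartAt (EuclideanSpace ℝ (Fin n)) p with hc
  have hmap : ContinuousOn (fun q : M × ℝ => (c q.1, q.2)) (c.source ×ˢ Ico 0 T) :=
    (c.continuousOn.comp continuousOn_fst fun q hq => hq.1).prodMk continuousOn_snd
  have hmaps : MapsTo (fun q : M × ℝ => (c q.1, q.2)) (c.source ×ˢ Ico 0 T)
      (c.target ×ˢ Ico 0 T) := fun q hq => ⟨c.map_source hq.1, hq.2⟩
  have h1 := fun i : Fin n => ((contDiffOn_fderiv_slice c.open_target (uniqueDiffOn_Ico 0 T)
    (hX.contDiffOn_spaceTimeRep p) (EuclideanSpace.single i 1)).continuousOn).comp hmap hmaps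
  refine continuousOn_pi.mpr fun i => continuousOn_pi.mpr fun j => ?_
  exact (h1 i).inner (𝕜 := ℝ) (h1 j)

theorem continuousOn_secondFFAt (hX : IsGaussCurvatureFlow α T X ν) (p : M) :
    ContinuousOn (fun q : M × ℝ => secondFFAt (localRep (fun x => X x q.2) p)
      (chartAt (EuclideanSpace ℝ (Fin n)) p q.1) (ν q.1 q.2))
      ((chartAt (EuclideanSpace ℝ (Fin n)) p).source ×ˢ Ico 0 T) := by
  set c := chartAt (EuclideanSpace ℝ (Fin n)) p with hc
  have hmap : ContinuousOn (fun q : M × ℝ => (c q.1, q.2)) (c.source ×ˢ Ico 0 T) :=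
    (c.continuousOn.comp continuousOn_fst fun q hq => hq.1).prodMk continuousOn_snd
  have hmaps : MapsTo (fun q : M × ℝ => (c q.1, q.2)) (c.source ×ˢ Ico 0 T)
      (c.target ×ˢ Ico 0 T) := fun q hq => ⟨c.map_source hq.1, hq.2⟩
  have h1 := fun i j : Fin n => ((contDiffOn_fderiv_slice c.open_target (uniqueDiffOn_Ico 0 T)
    (contDiffOn_fderiv_slice c.open_target (uniqueDiffOn_Ico 0 T)
    (hX.contDiffOn_spaceTimeRep p) (EuclideanSpace.single j 1))
      (EuclideanSpace.single i 1)).continuousOn).comp hmap hmaps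
  refine continuousOn_pi.mpr fun i => continuousOn_pi.mpr fun j => ?_
  exact ((h1 i j).inner (𝕜 := ℝ) (hX.normal_continuous.mono
    (prod_mono_left (subset_univ _)))).neg

theorem metricAt_posDef (hX : IsGaussCurvatureFlow α T X ν) (p : M) {t : ℝ} (ht : t ∈ Ico 0 T)
    {u : EuclideanSpace ℝ (Fin n)} (hu : u ∈ (chartAt (EuclideanSpace ℝ (Fin n)) p).target) :
    (metricAt (localRep (fun x => X x t) p) u).PosDef :=
  GaussFlow.metricAt_posDef (fderiv_localRep_injective (hX.embedding t ht).isImmersion p hu)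

theorem curvatureAt_eq (hX : IsGaussCurvatureFlow α T X ν) {p x : M} {t : ℝ} (ht : t ∈ Ico 0 T)
    (hx : x ∈ (chartAt (EuclideanSpace ℝ (Fin n)) p).source) :
    curvatureAt X ν x t =
      (secondFFAt (localRep (fun x => X x t) p) (chartAt (EuclideanSpace ℝ (Fin n)) p x)
        (ν x t)).det /
      (metricAt (localRep (fun x => X x t) p) (chartAt (EuclideanSpace ℝ (Fin n)) p x)).det :=
  gaussCurvature_eq_det_div_det (hX.contMDiff_slice ht) hx (hX.normal t ht x).orthogonal

theorem continuousOn_curvatureAt (hX : IsGaussCurvatureFlow α T X ν) :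
    ContinuousOn (fun q : M × ℝ => curvatureAt X ν q.1 q.2) (univ ×ˢ Ico 0 T) := by
  rintro ⟨p, t⟩ ⟨-, ht⟩
  set c := chartAt (EuclideanSpace ℝ (Fin n)) p with hc
  have hp : p ∈ c.source := mem_chart_source _ p
  have h1 : ContinuousOn (fun q : M × ℝ => curvatureAt X ν q.1 q.2) (c.source ×ˢ Ico 0 T) := by
    refine ContinuousOn.congr (ContinuousOn.div
      (Continuous.comp_continuousOn (continuous_id.matrix_det) (hX.continuousOn_secondFFAt p))
      (Continuous.comp_continuousOn (continuous_id.matrix_det) (hX.continuousOn_metricAt p))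
      fun q hq => ?_) fun q hq => ?_
    · exact (hX.metricAt_posDef p hq.2 (c.map_source hq.1)).det_pos.ne'
    · exact hX.curvatureAt_eq hq.2 hq.1
  refine (h1 (p, t) ⟨hp, ht⟩).mono_of_mem_nhdsWithin ?_
  have : c.source ×ˢ univ ∈ 𝓝 (p, t) := prod_mem_nhds (c.open_source.mem_nhds hp) univ_mem
  filter_upwards [mem_nhdsWithin_of_mem_nhds this, self_mem_nhdsWithin] with q h2 h3
  exact ⟨h2.1, h3.2⟩

/-- Strict convexity is an open condition in time. -/
theorem eventually_isStrictlyConvex [CompactSpace M] (hX : IsGaussCurvatureFlow α T X ν) {t : ℝ}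
    (ht : t ∈ Ico 0 T) (hconv : IsStrictlyConvex (fun x => X x t) (fun x => ν x t)) :
    ∀ᶠ s in 𝓝 t, s ∈ Ico 0 T → IsStrictlyConvex (fun x => X x s) (fun x => ν x s) := by
  have key : ∀ᶠ s in 𝓝 t, ∀ x ∈ (univ : Set M), s ∈ Ico 0 T →
      (secondFF (fun x => X x s) x (ν x s)).PosDef := by
    refine isCompact_univ.eventually_forall_of_forall_eventually fun p _ => ?_
    set c := chartAt (EuclideanSpace ℝ (Fin n)) p with hc
    have hp : p ∈ c.source := mem_chart_source _ p
    have hcont := hX.continuousOn_secondFFAt p (p, t) ⟨hp, ht⟩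
    have h0 := (secondFF_posDef_iff (hX.contMDiff_slice ht) hp
      (hX.normal t ht p).orthogonal).mp (hconv p)
    have h1 := eventually_posDef hcont h0 (by
      filter_upwards [self_mem_nhdsWithin] with q hq
      exact secondFFAt_isHermitian
        (contDiffAt_localRep (hX.contMDiff_slice hq.2) (c.map_source hq.1)) _)
    -- The compactness principle expects the parameter t first and the point p second.
    rw [eventually_nhdsWithin_iff, nhds_prod_eq, Filter.eventually_swap_iff,
      ← nhds_prod_eq] at h1
    have h2 : univ ×ˢ c.source ∈ 𝓝 (t, p) :=
      prod_mem_nhds univ_mem (c.open_source.mem_nhds hp)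
    filter_upwards [h1, h2] with q hq hq2 hqI
    exact (secondFF_posDef_iff (hX.contMDiff_slice hqI) hq2.2
      (hX.normal _ hqI q.2).orthogonal).mpr (hq ⟨hq2.2, hqI⟩)
  filter_upwards [key] with s hs hsI x using hs x (mem_univ x) hsI

end IsGaussCurvatureFlow

end Flow

/-! ### The maximum principle and preservation of convexity. -/

section MaximumPrinciple

variable {n : ℕ} {M : Type*} [TopologicalSpace M] [ChartedSpace (EuclideanSpace ℝ (Fin n)) M]
  {α T : ℝ} {X ν : M → ℝ → EuclideanSpace ℝ (Fin (n + 1))} [IsManifold (𝓡 n) ∞ M]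

namespace IsGaussCurvatureFlow

theorem eventually_curvatureAt_pos (hX : IsGaussCurvatureFlow α T X ν) {p : M} {t : ℝ}
    (ht : t ∈ Ioo 0 T) (hK : 0 < curvatureAt X ν p t) :
    ∀ᶠ q in 𝓝 (chartAt (EuclideanSpace ℝ (Fin n)) p p, t),
      0 < curvatureAt X ν ((chartAt (EuclideanSpace ℝ (Fin n)) p).symm q.1) q.2 := by
  set c := chartAt (EuclideanSpace ℝ (Fin n)) p with hc
  have hp : p ∈ c.source := mem_chart_source _ p
  have h1 : ContinuousAt (fun q : M × ℝ => curvatureAt X ν q.1 q.2) (p, t) :=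
    (hX.continuousOn_curvatureAt).continuousAt
      (prod_mem_nhds univ_mem (Ico_mem_nhds ht.1 ht.2))
  have h2 : ContinuousAt (fun q : EuclideanSpace ℝ (Fin n) × ℝ => (c.symm q.1, q.2)) (c p, t) :=
    ((c.symm.continuousAt (c.map_source hp)).comp (x := (c p, t)) continuousAt_fst).prodMk
      continuousAt_snd
  have h3 : Tendsto (fun q : EuclideanSpace ℝ (Fin n) × ℝ => (c.symm q.1, q.2)) (𝓝 (c p, t))
      (𝓝 (p, t)) := by
    have := h2.tendsto
    rwa [c.left_inv hp] at this
  exact h3.eventually (h1.eventually (lt_mem_nhds hK))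

/-- Near a point of positive curvature, the speed and the normal of the flow are smooth, being
read off from the time derivative, and the flow is a normal flow. -/
theorem isNormalFlowAt (hX : IsGaussCurvatureFlow α T X ν) {p : M} {t : ℝ}
    (ht : t ∈ Ioo 0 T) (hK : 0 < curvatureAt X ν p t) :
    ∃ (N : EuclideanSpace ℝ (Fin n) × ℝ → EuclideanSpace ℝ (Fin (n + 1)))
      (f : EuclideanSpace ℝ (Fin n) × ℝ → ℝ),
      IsNormalFlowAt (spaceTimeRep X p) N f
        (fun i : Fin n => ((EuclideanSpace.single i 1 : EuclideanSpace ℝ (Fin n)), (0 : ℝ)))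
        (0, 1) (chartAt (EuclideanSpace ℝ (Fin n)) p p, t) ∧
      ∀ᶠ q in 𝓝 (chartAt (EuclideanSpace ℝ (Fin n)) p p, t),
        N q = ν ((chartAt (EuclideanSpace ℝ (Fin n)) p).symm q.1) q.2 ∧
        f q = curvatureAt X ν ((chartAt (EuclideanSpace ℝ (Fin n)) p).symm q.1) q.2 ^ α := by
  set c := chartAt (EuclideanSpace ℝ (Fin n)) p with hc
  have hp : p ∈ c.source := mem_chart_source _ p
  set Y := spaceTimeRep X p with hY
  set τ : EuclideanSpace ℝ (Fin n) × ℝ := (0, 1)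
  set q₀ : EuclideanSpace ℝ (Fin n) × ℝ := (c p, t) with hq₀
  have hq₀S : q₀ ∈ c.target ×ˢ Ioo 0 T := ⟨c.map_source hp, ht⟩
  have hS : ∀ᶠ q in 𝓝 q₀, q ∈ c.target ×ˢ Ioo 0 T :=
    (c.open_target.prod isOpen_Ioo).mem_nhds hq₀S
  have hYq₀ : ContDiffAt ℝ ∞ Y q₀ := hX.contDiffAt_spaceTimeRep p hq₀S
  -- Speed and normal are defined from ∂ₜY alone; the norm is smooth away from zero, so no
  -- regularity of ν is needed.
  set f : EuclideanSpace ℝ (Fin n) × ℝ → ℝ := fun q => ‖fderiv ℝ Y q τ‖ with hf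
  set N : EuclideanSpace ℝ (Fin n) × ℝ → EuclideanSpace ℝ (Fin (n + 1)) :=
    fun q => -((f q)⁻¹ • fderiv ℝ Y q τ) with hN
  have hev : ∀ᶠ q in 𝓝 q₀, N q = ν (c.symm q.1) q.2 ∧
      f q = curvatureAt X ν (c.symm q.1) q.2 ^ α ∧ 0 < f q := by
    filter_upwards [hS, hX.eventually_curvatureAt_pos ht hK] with q hq hKq
    have h1 : fderiv ℝ Y q τ = _ := hX.fderiv_spaceTimeRep_time p hq
    have hpos := Real.rpow_pos_of_pos hKq α
    have hfq : f q = curvatureAt X ν (c.symm q.1) q.2 ^ α := by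
      rw [hf]
      simp only
      rw [h1, norm_neg, norm_smul, (hX.normal q.2 (Ioo_subset_Ico_self hq.2) _).norm_eq_one,
        mul_one, Real.norm_of_nonneg hpos.le]
    refine ⟨?_, hfq, hfq ▸ hpos⟩
    rw [hN]
    simp only
    rw [hfq, h1, smul_neg, neg_neg, smul_smul, inv_mul_cancel₀ hpos.ne', one_smul]
  have hf₀ : 0 < f q₀ := hev.self_of_nhds.2.2
  have hdτ : ContDiffAt ℝ ∞ (fun q => fderiv ℝ Y q τ) q₀ := contDiffAt_fderiv_apply hYq₀ τ
  have hfs : ContDiffAt ℝ ∞ f q₀ := hdτ.norm ℝ (norm_pos_iff.mp hf₀)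
  have hNs : ContDiffAt ℝ ∞ N q₀ := ((hfs.inv hf₀.ne').smul hdτ).neg
  have horth : ∀ q ∈ c.target ×ˢ Ioo 0 T, ∀ w,
      inner ℝ (fderiv ℝ Y q (w, 0)) (ν (c.symm q.1) q.2) = 0 := by
    intro q hq w
    have h1 := (exists_jacobian (hX.contMDiff_slice (Ioo_subset_Ico_self hq.2))
      (c.map_target hq.1)
      (hX.normal q.2 (Ioo_subset_Ico_self hq.2) (c.symm q.1)).orthogonal).1 w
    rw [← hc, c.right_inv hq.1] at h1
    rw [← fderiv_slice ((hX.contDiffAt_spaceTimeRep p hq).differentiableAt (by simp))]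
    exact h1
  refine ⟨N, f, ⟨hYq₀, hNs, hfs, ?_, ?_, fun i => ?_, fun w hw1 hw2 => ?_⟩,
    hev.mono fun q hq => ⟨hq.1, hq.2.1⟩⟩
  · filter_upwards [hev] with q hq
    rw [hN]
    simp only
    rw [smul_neg, neg_neg, smul_smul, mul_inv_cancel₀ hq.2.2.ne', one_smul]
  · filter_upwards [hev, hS] with q hq hqS
    rw [hq.1, real_inner_self_eq_norm_sq,
      (hX.normal q.2 (Ioo_subset_Ico_self hqS.2) _).norm_eq_one, one_pow]
  · filter_upwards [hev, hS] with q hq hqS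
    rw [hq.1]
    exact horth q hqS _
  · have hN₀ : N q₀ = ν p t := by
      rw [hev.self_of_nhds.1, hq₀]
      simp only [c.left_inv hp]
    have hsl : ∀ x, fderiv ℝ (localRep (fun y => X y t) p) (c p) x = fderiv ℝ Y q₀ (x, 0) :=
      fun x => fderiv_slice (q := q₀) (hYq₀.differentiableAt (by simp)) x
    have hνt := hX.normal t (Ioo_subset_Ico_self ht) p
    rw [hN₀] at hw1
    refine eq_zero_of_inner_normal_of_inner_tangent
      (fderiv_localRep_injective (hX.embedding t (Ioo_subset_Ico_self ht)).isImmersion p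
        (c.map_source hp)) (v := ν p t) ?_ ?_ hw1 ?_
    · rw [← norm_ne_zero_iff, hνt.norm_eq_one]
      exact one_ne_zero
    · intro x
      have := horth q₀ hq₀S x
      rw [hsl]
      rwa [show c.symm q₀.1 = p from c.left_inv hp] at this
    · intro x
      rw [map_eq_sum, inner_sum]
      refine Finset.sum_eq_zero fun i _ => ?_
      rw [inner_smul_right, hsl, hw2 i, mul_zero]

/-- Under the flow, a strictly convex point cannot be a minimum of the Gauss curvature in space
and in the past. -/
theorem exists_curvatureAt_lt (hn : 1 ≤ n) (hα : 0 < α) (hX : IsGaussCurvatureFlow α T X ν)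
    {p : M} {t : ℝ} (ht : t ∈ Ioo 0 T) (hconv : (secondFF (fun x => X x t) p (ν p t)).PosDef)
    (hspace : ∀ x, curvatureAt X ν p t ≤ curvatureAt X ν x t) :
    ∃ s ∈ Ico 0 t, curvatureAt X ν p s < curvatureAt X ν p t := by
  -- Strict positivity of tr(g⁻¹h) needs n ≥ 1.
  have : Nonempty (Fin n) := ⟨⟨0, hn⟩⟩
  by_contra! htime
  set c := chartAt (EuclideanSpace ℝ (Fin n)) p with hc
  have hp : p ∈ c.source := mem_chart_source _ p
  set q₀ : EuclideanSpace ℝ (Fin n) × ℝ := (c p, t) with hq₀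
  have hgpos : ∀ s ∈ Ico 0 T, (metricAt (localRep (fun x => X x s) p) (c p)).PosDef :=
    fun s hs => hX.metricAt_posDef p hs (c.map_source hp)
  have htI := Ioo_subset_Ico_self ht
  have hK : 0 < curvatureAt X ν p t := by
    rw [hX.curvatureAt_eq htI hp]
    exact div_pos (Matrix.PosDef.det_pos hconv) (hgpos t htI).det_pos
  obtain ⟨N, f, hflow, hev⟩ := hX.isNormalFlowAt ht hK
  rw [← hc, ← hq₀] at hflow hev
  have hf₀ : f q₀ = curvatureAt X ν p t ^ α := by
    rw [hev.self_of_nhds.2, hq₀]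
    simp only [c.left_inv hp]
  have hfpos : 0 < f q₀ := by
    rw [hf₀]
    exact Real.rpow_pos_of_pos hK α
  set e : Fin n → EuclideanSpace ℝ (Fin n) × ℝ :=
    fun i => (EuclideanSpace.single i 1, 0) with he
  have hmin : ∀ x : Fin n → ℝ, IsLocalMin (fun s : ℝ => f (q₀ + s • ∑ i, x i • e i)) 0 := by
    intro x
    have hl : Tendsto (fun s : ℝ => q₀ + s • ∑ i, x i • e i) (𝓝 0) (𝓝 q₀) := by
      have : Continuous (fun s : ℝ => q₀ + s • ∑ i, x i • e i) := by fun_prop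
      simpa using this.tendsto 0
    -- The directions `e i` have no time component, so the line stays in the slice at time t, where
    -- `hspace` applies.
    have hsnd : ∀ s : ℝ, (q₀ + s • ∑ i, x i • e i).2 = t := by
      intro s
      simp [he, hq₀, Prod.snd_sum]
    filter_upwards [hl.eventually hev] with s hs
    simp only [zero_smul, add_zero]
    rw [hs.2, hf₀, hsnd]
    exact Real.rpow_le_rpow hK.le (hspace _) hα.le
  have hcrit : ∀ i, fderiv ℝ f q₀ (e i) = 0 := by
    intro i
    have h1 := fderiv_apply_eq_zero_of_isLocalMin_line hflow.smooth_speed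
      (hmin (Pi.single i 1))
    simpa [Pi.single_apply] using h1
  have hD := hessian_posSemidef hflow.smooth_speed hmin
  set g : ℝ → Matrix (Fin n) (Fin n) ℝ :=
    fun s => metricAt (localRep (fun x => X x s) p) (c p) with hg
  set b : ℝ → Matrix (Fin n) (Fin n) ℝ :=
    fun s => secondFFAt (localRep (fun x => X x s) p) (c p) (ν p s) with hb
  have hline : Tendsto (fun s : ℝ => (c p, s)) (𝓝 t) (𝓝 q₀) :=
    Continuous.tendsto (by fun_prop) t
  have hIoo : ∀ᶠ s in 𝓝 t, s ∈ Ioo 0 T := Ioo_mem_nhds ht.1 ht.2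
  have hgev : ∀ i j, (fun s => g s i j) =ᶠ[𝓝 t] fun s =>
      inner ℝ (fderiv ℝ (spaceTimeRep X p) (c p, s) (e i))
        (fderiv ℝ (spaceTimeRep X p) (c p, s) (e j)) := by
    intro i j
    filter_upwards [hIoo] with s hs
    have hd := (hX.contDiffAt_spaceTimeRep p (q := (c p, s))
      ⟨c.map_source hp, hs⟩).differentiableAt (by simp)
    rw [he]
    simp only
    rw [← fderiv_slice hd, ← fderiv_slice hd]
    rfl
  have hbev : ∀ i j, (fun s => b s i j) =ᶠ[𝓝 t] fun s =>
      -inner ℝ (fderiv ℝ (fun r => fderiv ℝ (spaceTimeRep X p) r (e j)) (c p, s) (e i))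
        (N (c p, s)) := by
    intro i j
    filter_upwards [hIoo, hline.eventually hev] with s hs hNs
    rw [hNs.1, he]
    simp only
    rw [← fderiv_fderiv_slice (hX.contDiffAt_spaceTimeRep p (q := (c p, s))
      ⟨c.map_source hp, hs⟩), c.left_inv hp]
    rfl
  have hg' : ∀ i j, HasDerivAt (fun s => g s i j) (((-2 * f q₀) • b t) i j) t := by
    intro i j
    refine HasDerivAt.congr_of_eventuallyEq ?_ (hgev i j)
    have hd : DifferentiableAt ℝ (fun q => inner ℝ (fderiv ℝ (spaceTimeRep X p) q (e i))
        (fderiv ℝ (spaceTimeRep X p) q (e j))) (c p, t) :=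
      ((contDiffAt_fderiv_apply hflow.smooth _).inner ℝ
        (contDiffAt_fderiv_apply hflow.smooth _)).differentiableAt (by simp)
    have h1 := hasDerivAt_time_line hd
    rw [hflow.fderiv_metric] at h1
    have hbij : b t i j = -inner ℝ (fderiv ℝ (fun r => fderiv ℝ (spaceTimeRep X p) r (e j)) q₀
        (e i)) (N q₀) := (hbev i j).self_of_nhds
    rw [Matrix.smul_apply, smul_eq_mul, hbij]
    exact h1
  have hgt : g t = Matrix.of fun i j => inner ℝ (fderiv ℝ (spaceTimeRep X p) q₀ (e i))
      (fderiv ℝ (spaceTimeRep X p) q₀ (e j)) := by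
    ext i j
    exact (hgev i j).self_of_nhds
  have hbt : b t = Matrix.of fun i j =>
      -inner ℝ (fderiv ℝ (fun r => fderiv ℝ (spaceTimeRep X p) r (e j)) q₀ (e i)) (N q₀) := by
    ext i j
    exact (hbev i j).self_of_nhds
  have hb' : ∀ i j, HasDerivAt (fun s => b s i j)
      (((Matrix.of fun i j => fderiv ℝ (fun q => fderiv ℝ f q (e j)) q₀ (e i))
        - f q₀ • (b t * (g t)⁻¹ * b t)) i j) t := by
    intro i j
    refine HasDerivAt.congr_of_eventuallyEq ?_ (hbev i j)
    have hd : DifferentiableAt ℝ (fun q =>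
        -inner ℝ (fderiv ℝ (fun r => fderiv ℝ (spaceTimeRep X p) r (e j)) q (e i)) (N q))
        (c p, t) :=
      ((contDiffAt_fderiv_apply (contDiffAt_fderiv_apply hflow.smooth _) _).inner ℝ
        hflow.smooth_normal).neg.differentiableAt (by simp)
    have h1 := hasDerivAt_time_line hd
    rw [hflow.fderiv_secondFF hcrit,
      hflow.inner_fderiv_normal_fderiv_normal hgt hbt (hgpos t htI).det_pos.ne'] at h1
    exact h1
  have hpos := trace_adjugate_evolution_pos (hgpos t htI) (h := b t) hconv hD hfpos rfl rfl
  -- The coefficient of det g is the constant K(p, t), so no derivative of K itself enters.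
  have hψ := (hasDerivAt_det hb').sub ((hasDerivAt_det hg').const_mul (((g t)⁻¹ * b t).det))
  refine absurd (nonpos_of_hasDerivAt_of_le_left hψ ?_) (not_le.mpr hpos)
  -- Definitional, because the fixed chart is the preferred chart at p.
  have hKt : ((g t)⁻¹ * b t).det = curvatureAt X ν p t := rfl
  have hdet : ∀ s ∈ Ico 0 T, (b s).det = curvatureAt X ν p s * (g s).det := by
    intro s hs
    rw [hX.curvatureAt_eq hs hp, div_mul_cancel₀ _ (hgpos s hs).det_pos.ne']
  filter_upwards [Ioo_mem_nhdsLT ht.1] with s hs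
  have hsT : s ∈ Ico 0 T := ⟨hs.1.le, hs.2.trans ht.2⟩
  simp only [Pi.sub_apply]
  rw [hKt, hdet t htI, hdet s hsT, sub_self, ← sub_mul]
  exact mul_nonneg (sub_nonneg.mpr (htime s ⟨hs.1.le, hs.2⟩)) (hgpos s hsT).det_pos.le

variable [CompactSpace M] [Nonempty M]

theorem exists_isMinOn_curvatureAt (hX : IsGaussCurvatureFlow α T X ν) {t₁ : ℝ}
    (ht₁ : t₁ ∈ Ico 0 T) : ∃ p, ∃ t ∈ Icc 0 t₁, ∀ x, ∀ s ∈ Icc 0 t₁,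
      curvatureAt X ν p t ≤ curvatureAt X ν x s := by
  have hsub : (univ : Set M) ×ˢ Icc 0 t₁ ⊆ univ ×ˢ Ico 0 T :=
    prod_mono_right (Icc_subset_Ico_right ht₁.2)
  obtain ⟨⟨p, t⟩, ⟨-, ht⟩, hmin⟩ := (isCompact_univ.prod isCompact_Icc).exists_isMinOn
    ⟨(Classical.arbitrary M, 0), mem_univ _, left_mem_Icc.mpr ht₁.1⟩
    (hX.continuousOn_curvatureAt.mono hsub)
  exact ⟨p, t, ht, fun x s hs => hmin (a := (x, s)) ⟨mem_univ _, hs⟩⟩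

theorem bddBelow_range_curvatureAt (hX : IsGaussCurvatureFlow α T X ν) {t : ℝ}
    (ht : t ∈ Ico 0 T) : BddBelow (range fun x => curvatureAt X ν x t) := by
  obtain ⟨p, s, -, hmin⟩ := hX.exists_isMinOn_curvatureAt ht
  refine ⟨curvatureAt X ν p s, ?_⟩
  rintro _ ⟨x, rfl⟩
  exact hmin x t ⟨ht.1, le_rfl⟩

/-- As long as the flow is strictly convex, the minimum of the curvature does not decrease. -/
theorem iInf_curvatureAt_le (hn : 1 ≤ n) (hα : 0 < α) (hX : IsGaussCurvatureFlow α T X ν)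
    {t₁ : ℝ} (ht₁ : t₁ ∈ Ico 0 T)
    (hconv : ∀ t ∈ Icc 0 t₁, IsStrictlyConvex (fun x => X x t) (fun x => ν x t)) (x : M) :
    ⨅ y, curvatureAt X ν y 0 ≤ curvatureAt X ν x t₁ := by
  obtain ⟨p, t, ht, hmin⟩ := hX.exists_isMinOn_curvatureAt ht₁
  have ht0 : t = 0 := by
    by_contra hne
    have htI : t ∈ Ioo 0 T := ⟨lt_of_le_of_ne ht.1 (Ne.symm hne), ht.2.trans_lt ht₁.2⟩
    obtain ⟨s, hs, hlt⟩ := hX.exists_curvatureAt_lt hn hα htI (hconv t ht p)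
      (fun y => hmin y t ht)
    exact absurd (hmin p s ⟨hs.1, hs.2.le.trans ht.2⟩) (not_le.mpr hlt)
  subst ht0
  exact (ciInf_le (hX.bddBelow_range_curvatureAt ⟨le_rfl, ht₁.1.trans_lt ht₁.2⟩) p).trans
    (hmin x t₁ ⟨ht₁.1, le_rfl⟩)

theorem iInf_curvatureAt_zero_pos (hX : IsGaussCurvatureFlow α T X ν) (hT : 0 < T)
    (h0 : IsStrictlyConvex (fun x => X x 0) (fun x => ν x 0)) :
    0 < ⨅ x, curvatureAt X ν x 0 := by
  have hI : (0 : ℝ) ∈ Ico 0 T := ⟨le_rfl, hT⟩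
  obtain ⟨p, t, ht, hmin⟩ := hX.exists_isMinOn_curvatureAt hI
  have ht0 : t = 0 := le_antisymm ht.2 ht.1
  subst ht0
  have hp := mem_chart_source (EuclideanSpace ℝ (Fin n)) p
  have hK : 0 < curvatureAt X ν p 0 := by
    rw [hX.curvatureAt_eq hI hp]
    exact div_pos (Matrix.PosDef.det_pos (h0 p))
      (hX.metricAt_posDef p hI ((chartAt _ p).map_source hp)).det_pos
  exact hK.trans_le (le_ciInf fun x => hmin x 0 ht)

/-- Strict convexity passes to the limit in time. -/
theorem isStrictlyConvex_of_forall_lt (hn : 1 ≤ n) (hα : 0 < α)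
    (hX : IsGaussCurvatureFlow α T X ν) {t₁ : ℝ} (ht₁ : t₁ ∈ Ioo 0 T)
    (hconv : ∀ t ∈ Ico 0 t₁, IsStrictlyConvex (fun x => X x t) (fun x => ν x t)) :
    IsStrictlyConvex (fun x => X x t₁) (fun x => ν x t₁) := by
  intro p
  have hT : 0 < T := ht₁.1.trans ht₁.2
  have ht₁I := Ioo_subset_Ico_self ht₁
  have hp := mem_chart_source (EuclideanSpace ℝ (Fin n)) p
  have hIoo : Ioo 0 t₁ ∈ 𝓝[<] t₁ := Ioo_mem_nhdsLT ht₁.1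
  have hIco : Ico 0 T ∈ 𝓝[<] t₁ := by
    filter_upwards [hIoo] with s hs using ⟨hs.1.le, hs.2.trans ht₁.2⟩
  have hto : Tendsto (fun s : ℝ => (p, s)) (𝓝[<] t₁)
      (𝓝[(chartAt (EuclideanSpace ℝ (Fin n)) p).source ×ˢ Ico 0 T] (p, t₁)) := by
    refine tendsto_nhdsWithin_iff.mpr ⟨?_, ?_⟩
    · exact (Continuous.tendsto (by fun_prop) t₁).mono_left nhdsWithin_le_nhds
    · filter_upwards [hIco] with s hs using ⟨hp, hs⟩
  have hb := (hX.continuousOn_secondFFAt p (p, t₁) ⟨hp, ht₁I⟩).tendsto.comp hto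
  have hpsd : (secondFF (fun x => X x t₁) p (ν p t₁)).PosSemidef := by
    refine posSemidef_of_tendsto hb ?_
    filter_upwards [hIoo] with s hs
    exact (hconv s ⟨hs.1.le, hs.2⟩ p).posSemidef
  -- The bound holds at each earlier time, where the flow has been strictly convex so far, and
  -- passes to t₁ by continuity of K.
  have hK : ⨅ y, curvatureAt X ν y 0 ≤ curvatureAt X ν p t₁ := by
    have hto' : Tendsto (fun s : ℝ => (p, s)) (𝓝[<] t₁) (𝓝[univ ×ˢ Ico 0 T] (p, t₁)) :=
      hto.mono_right (nhdsWithin_mono _ (prod_mono_left (subset_univ _)))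
    refine ge_of_tendsto ((hX.continuousOn_curvatureAt (p, t₁)
      ⟨mem_univ _, ht₁I⟩).tendsto.comp hto') ?_
    filter_upwards [hIoo] with s hs
    exact hX.iInf_curvatureAt_le hn hα ⟨hs.1.le, hs.2.trans ht₁.2⟩
      (fun r hr => hconv r ⟨hr.1, hr.2.trans_lt hs.2⟩) p
  have hpos := (hX.iInf_curvatureAt_zero_pos hT (hconv 0 ⟨le_rfl, ht₁.1⟩)).trans_le hK
  refine hpsd.posDef_iff_det_ne_zero.mpr fun hzero => hpos.ne' ?_
  rw [hX.curvatureAt_eq ht₁I hp]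
  exact div_eq_zero_iff.mpr (Or.inl hzero)

/-- Let t₁ be the infimum of the bad times. Convexity holds at t₁, as the initial condition or as a
limit of good times, hence also at all flow times near t₁; but bad times accumulate at t₁ or include
it. -/
theorem isStrictlyConvex (hn : 1 ≤ n) (hα : 0 < α) (hX : IsGaussCurvatureFlow α T X ν)
    (h0 : IsStrictlyConvex (fun x => X x 0) (fun x => ν x 0)) :
    ∀ t ∈ Ico 0 T, IsStrictlyConvex (fun x => X x t) (fun x => ν x t) := by
  by_contra! hbad
  obtain ⟨t₂, ht₂, hnc⟩ := hbad
  set B : Set ℝ := {t | t ∈ Ico 0 T ∧ ¬ IsStrictlyConvex (fun x => X x t) (fun x => ν x t)}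
  have hBne : B.Nonempty := ⟨t₂, ht₂, hnc⟩
  have hBbdd : BddBelow B := ⟨0, fun t ht => ht.1.1⟩
  set t₁ := sInf B with ht₁
  have h0t₁ : 0 ≤ t₁ := le_csInf hBne fun t ht => ht.1.1
  have ht₁T : t₁ ∈ Ico 0 T := ⟨h0t₁, (csInf_le hBbdd ⟨ht₂, hnc⟩).trans_lt ht₂.2⟩
  have hbefore : ∀ t ∈ Ico 0 t₁, IsStrictlyConvex (fun x => X x t) (fun x => ν x t) := by
    intro t ht
    by_contra hc
    exact absurd (csInf_le hBbdd ⟨⟨ht.1, ht.2.trans ht₁T.2⟩, hc⟩) (not_le.mpr ht.2)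
  have hat : IsStrictlyConvex (fun x => X x t₁) (fun x => ν x t₁) := by
    rcases h0t₁.eq_or_lt with h | h
    · rw [← h]
      exact h0
    · exact hX.isStrictlyConvex_of_forall_lt hn hα ⟨h, ht₁T.2⟩ hbefore
  have hcl : t₁ ∈ closure B := csInf_mem_closure hBne hBbdd
  obtain ⟨s, hs, hsB⟩ := mem_closure_iff_nhds.mp hcl _ (hX.eventually_isStrictlyConvex ht₁T hat)
  exact hsB.2 (hs hsB.1)

end IsGaussCurvatureFlow

end MaximumPrinciple

end GaussFlow

theorem lemma3p1 {n : ℕ} (hn : 1 ≤ n)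
    {M : Type*} [TopologicalSpace M] [ChartedSpace (EuclideanSpace ℝ (Fin n)) M]
    [IsManifold (𝓡 n) ∞ M] [CompactSpace M] [ConnectedSpace M]
    {α T : ℝ} (hα : 0 < α) (hT : 0 < T)
    (X ν : M → ℝ → EuclideanSpace ℝ (Fin (n + 1)))
    (hX : GaussFlow.IsGaussCurvatureFlow α T X ν)
    (h0 : GaussFlow.IsStrictlyConvex (fun x => X x 0) (fun x => ν x 0)) :
    (∀ t ∈ Ico 0 T, GaussFlow.IsStrictlyConvex (fun x => X x t) (fun x => ν x t)) ∧
    (∀ t ∈ Ico 0 T,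
      (⨅ x, GaussFlow.curvatureAt X ν x 0) ≤ ⨅ x, GaussFlow.curvatureAt X ν x t) ∧
    0 < ⨅ x, GaussFlow.curvatureAt X ν x 0 := by
  have hconv := hX.isStrictlyConvex hn hα h0
  refine ⟨hconv, fun t ht => le_ciInf fun x => ?_, hX.iInf_curvatureAt_zero_pos hT h0⟩
  exact hX.iInf_curvatureAt_le hn hα ht (fun s hs => hconv s ⟨hs.1, hs.2.trans_lt ht.2⟩) x
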